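/- Let $Q$ be a finite-dimensional smooth manifold, $\tau_Q:TQ\to Q$ its tangent bundle, $S$ the vertical endomorphism and $\Delta$ the Liouville vector field of $TQ$. Let $L:TQ\to\mathbb R$ be a smooth regular Lagrangian (its fibre Hessian is nonsingular everywhere), with $\omega_L=-d(S^*dL)$ and $E_L=\Delta L-L$. Let $\mathcal D\subseteq TQ$ be a smooth distribution of constant rank such that the nonholonomic system $(Q,L,\mathcal D)$ is regular: with $F^o_v=S^*((T_v\mathcal D)^o)$ for $v\in\mathcal D$, one has $\dim (T_v\mathcal D)^o=\dim F^o_v$, and the only $Z\in T_v\mathcal D$ with $i_Z\omega_L\in F^o_v$ is $Z=0$. Let $\Gamma_{nh}$ be the nonholonomic dynamics, i.e. the unique vector field on $\mathcal D$, tangent to $\mathcal D$, with $i_{\Gamma_{nh}}\omega_L-dE_L\in F^o$ along $\mathcal D$, and let $F_{nh}:\mathcal D\to T^*Q$ be the nonholonomic force, i.e. the fibre-preserving map determined along $\mathcal D$ by $$i_{\Gamma_{nh}}\omega_L=dE_L-\mu_{F_{nh}},\qquad \langle\mu_{F_{nh}}(v),Y\rangle=\langle F_{nh}(v),T\tau_Q(Y)\rangle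 .$$ Let $\widetilde F_{nh}:TQ\to T^*Q$ be an arbitrary smooth fibre-preserving extension of $F_{nh}$, and let $\Gamma=\Gamma_{(L,\widetilde F_{nh})}$ be the vector field on $TQ$ with $i_\Gamma\omega_L=dE_L-\mu_{\widetilde F_{nh}}$. Let $h>0$, and write $\phi^{\Gamma}_t$, $\phi^{\Gamma_{nh}}_t$ for the flows on $TQ$ and on $\mathcal D$, and $\exp_h(v)=(\tau_Q(v),\tau_Q(\phi_h(v)))$ for the corresponding exponential maps. Let $W\subseteq TQ$ be an open set of points at which $\phi^\Gamma_t$ is defined for all $t\in[0,h]$ and which $\exp_h^\Gamma$ maps diffeomorphically onto an open subset of $Q\times Q$, and let $R^{e-}_{h,\widetilde F_{nh}}:\exp_h^\Gamma(W)\to W$ be the inverse. Let $\mathcal U_h\subseteq W\cap\mathcal D$ be an open subset of $\mathcal D$ consisting of points at which $\phi^{\Gamma_{nh}}_t$ is defined for all $t\in[0,h]$, put $\mathcal M_h^{e,nh}=\exp_h^{\Gamma_{nh}}(\mathcal U_h)\subseteq Q\times Q$, and let $R^{e-}_{h,nh}:\mathcal M_h^{e,nh}\to\mathcal U_h$ be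 the inverse of $\exp_h^{\Gamma_{nh}}|_{\mathcal U_h}$. Define, for $(q_0,q_1)\in \exp_h^\Gamma(W)$ and $(X_{q_0},X_{q_1})\in T_{q_0}Q\times T_{q_1}Q$, $$L^{e,h}_{d,\widetilde F_{nh}}(q_0,q_1)=\int_0^h \big(L\circ\phi^\Gamma_t\circ R^{e-}_{h,\widetilde F_{nh}}\big)(q_0,q_1)\,dt,$$ $$\langle F_d^{e,h}(q_0,q_1),(X_{q_0},X_{q_1})\rangle=\int_0^h\big\langle \big(\widetilde F_{nh}\circ\phi_t^\Gamma\circ R^{e-}_{h,\widetilde F_{nh}}\big)(q_0,q_1),\,T_{(q_0,q_1)}\big(\tau_Q\circ\phi_t^\Gamma\circ R^{e-}_{h,\widetilde F_{nh}}\big)(X_{q_0},X_{q_1})\big\rangle\,dt,$$ $$\langle(\widetilde F_{nh})_d^{e,-}(q_0,q_1),X_{q_0}\rangle=\langle F_d^{e,h}(q_0,q_1),(X_{q_0},0)\rangle,\qquad \langle(\widetilde F_{nh})_d^{e,+}(q_0,q_1),X_{q_1}\rangle=\langle F_d^{e,h}(q_0,q_1),(0,X_{q_1})\rangle,$$ and,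 for $(q_0,q_1)\in\mathcal M_h^{e,nh}$ and $(X_{q_0},X_{q_1})\in T_{(q_0,q_1)}\mathcal M_h^{e,nh}$, $$l^{e,h}_{d,nh}(q_0,q_1)=\int_0^h \big(L\circ\phi^{\Gamma_{nh}}_t\circ R^{e-}_{h,nh}\big)(q_0,q_1)\,dt,$$ $$\langle\beta_{nh}(q_0,q_1),(X_{q_0},X_{q_1})\rangle=\int_0^h\big\langle \big(F_{nh}\circ\phi_t^{\Gamma_{nh}}\circ R^{e-}_{h,nh}\big)(q_0,q_1),\,T_{(q_0,q_1)}\big(\tau_Q\circ\phi_t^{\Gamma_{nh}}\circ R^{e-}_{h,nh}\big)(X_{q_0},X_{q_1})\big\rangle\,dt .$$ Then $L^{e,h}_{d,\widetilde F_{nh}}\big|_{\mathcal M_h^{e,nh}}=l^{e,h}_{d,nh}$. Moreover, for all $(q_0,q_1)\in\mathcal M_h^{e,nh}$ and $(X_{q_0},X_{q_1})\in T_{(q_0,q_1)}\mathcal M_h^{e,nh}$, $$\langle(\widetilde F_{nh})_d^{e,-}(q_0,q_1),X_{q_0}\rangle+\langle(\widetilde F_{nh})_d^{e,+}(q_0,q_1),X_{q_1}\rangle=\langle\beta_{nh}(q_0,q_1),(X_{q_0},X_{q_1})\rangle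 .$$ -/

import Mathlib

open Set Filter Topology
open scoped Manifold ContDiff

noncomputable section

namespace Nonholonomic

/- Throughout, `Q` is a smooth boundaryless manifold modelled on a finite-dimensional real normed
space `E`; its tangent bundle is itself a manifold, modelled on `E × E`. -/

/-- The tangent space `T_q Q`. -/
abbrev Tan (E : Type*) [NormedAddCommGroup E] [NormedSpace ℝ E]
    {Q : Type*} [TopologicalSpace Q] [ChartedSpace E Q] (q : Q) : Type _ :=
  TangentSpace 𝓘(ℝ, E) q

/-- The tangent bundle `TQ`. -/
abbrev TB (E : Type*) [NormedAddCommGroup E] [NormedSpace ℝ E]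
    (Q : Type*) [TopologicalSpace Q] [ChartedSpace E Q] : Type _ :=
  TangentBundle 𝓘(ℝ, E) Q

section Basic

variable {E : Type*} [NormedAddCommGroup E] [NormedSpace ℝ E]
  {Q : Type*} [TopologicalSpace Q] [ChartedSpace E Q] [IsManifold 𝓘(ℝ, E) ∞ Q]

/-- The tangent space `T_v (TQ)` of the tangent bundle at `v`. -/
abbrev TTan (v : TB E Q) : Type _ := TangentSpace 𝓘(ℝ, E).tangent v

/-- The tangent map `T_v τ : T_v (TQ) → T_{τ v} Q` of the projection `τ : TQ → Q`. -/
def tanProj (v : TB E Q) : TTan v →L[ℝ] Tan E v.proj :=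
  mfderiv 𝓘(ℝ, E).tangent 𝓘(ℝ, E) (fun u : TB E Q => u.proj) v

/-- The vertical lift `w ↦ w^V_v`, `T_q Q → T_v (TQ)`, at `v ∈ T_q Q`: the derivative at `v` of the
inclusion of the fibre `T_q Q`, that is `w^V_v = d/dt (v + t w)` at `t = 0`. -/
def vertLift (v : TB E Q) : Tan E v.proj →L[ℝ] TTan v :=
  mfderiv 𝓘(ℝ, E) 𝓘(ℝ, E).tangent (fun w : E => (⟨v.proj, w⟩ : TB E Q)) v.2

/-- The vertical endomorphism `S X = (T τ X)^V`. -/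
def vertEndo (v : TB E Q) : TTan v →L[ℝ] TTan v :=
  (vertLift v).comp (tanProj v)

/-- The differential of a function on `TQ`. -/
def diffTB (f : TB E Q → ℝ) (v : TB E Q) : TTan v →L[ℝ] ℝ :=
  mfderiv 𝓘(ℝ, E).tangent 𝓘(ℝ, ℝ) f v

/-- The contraction `(dθ)_v (Z, ·)` of the exterior derivative of a 1-form `θ` on `TQ`, computed in
the chart `φ` of `TQ` at `v`: if `θ'` is the local representative of `θ`, then
`dθ (Z, Y) = (D θ' Z) Y - (D θ' Y) Z`. -/
def extDerivTB (θ : (v : TB E Q) → TTan v →L[ℝ] ℝ) (v : TB E Q) (Z : TTan v) : TTan v →L[ℝ] ℝ :=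
  let φ := extChartAt 𝓘(ℝ, E).tangent v
  let θ' : E × E → (E × E →L[ℝ] ℝ) := fun x =>
    (θ (φ.symm x)).comp (mfderiv 𝓘(ℝ, E × E) 𝓘(ℝ, E).tangent φ.symm x)
  let A : E × E →L[ℝ] E × E →L[ℝ] ℝ := fderiv ℝ θ' (φ v)
  let P : TTan v →L[ℝ] E × E := mfderiv 𝓘(ℝ, E).tangent 𝓘(ℝ, E × E) φ v
  (A (P Z)).comp P - (A.flip (P Z)).comp P

/-- The 1-form `S^* dL` on `TQ`. -/
def cartanOneForm (L : TB E Q → ℝ) (v : TB E Q) : TTan v →L[ℝ] ℝ :=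
  (diffTB L v).comp (vertEndo v)

/-- The contraction `i_Z ω_L` of the Poincaré–Cartan 2-form `ω_L = - d (S^* dL)`. -/
def contractOmega (L : TB E Q → ℝ) (v : TB E Q) (Z : TTan v) : TTan v →L[ℝ] ℝ :=
  - extDerivTB (cartanOneForm L) v Z

/-- The energy `E_L = Δ L - L`, where `Δ v = v^V_v` is the Liouville vector field. -/
def energy (L : TB E Q → ℝ) (v : TB E Q) : ℝ :=
  diffTB L v (vertLift v v.2) - L v

/-- `L` is regular: at every tangent vector the Hessian of `L` along the fibre is nonsingular. -/
def IsRegularLagrangian (L : TB E Q → ℝ) : Prop :=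
  ∀ v : TB E Q, ∀ w : E,
    (∀ w' : E, fderiv ℝ (fderiv ℝ (fun u : E => L ⟨v.proj, u⟩)) v.2 w w' = 0) → w = 0

/-- An external force, i.e. a fibre-preserving map `TQ → T^*Q`. -/
abbrev Force (E : Type*) [NormedAddCommGroup E] [NormedSpace ℝ E]
    (Q : Type*) [TopologicalSpace Q] [ChartedSpace E Q] : Type _ :=
  (v : TB E Q) → Tan E v.proj →L[ℝ] ℝ

/-- Smoothness of an external force, as a map from `TQ` to the cotangent bundle. -/
def IsSmoothForce (F : Force E Q) : Prop :=
  ContMDiff 𝓘(ℝ, E).tangent (𝓘(ℝ, E).prod 𝓘(ℝ, E →L[ℝ] ℝ)) ∞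
    (fun v : TB E Q => Bundle.TotalSpace.mk' (E →L[ℝ] ℝ)
      (E := fun q : Q => TangentSpace 𝓘(ℝ, E) q →L[ℝ] Bundle.Trivial Q ℝ q) v.proj (F v))

/-- The semibasic 1-form `μ_F` on `TQ` of an external force `F`. -/
def semibasic (v : TB E Q) (α : Tan E v.proj →L[ℝ] ℝ) : TTan v →L[ℝ] ℝ :=
  α.comp (tanProj v)

/-- The forced Lagrangian vector field `Γ_(L,F)`: the solution of `i_Γ ω_L = dE_L - μ_F`
(unique when `L` is regular). -/
def forcedField (L : TB E Q → ℝ) (F : Force E Q) (v : TB E Q) : TTan v :=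
  Classical.epsilon fun Z : TTan v =>
    contractOmega L v Z = diffTB (energy L) v - semibasic v (F v)

end Basic

section Tangent

variable {F : Type*} [NormedAddCommGroup F] [NormedSpace ℝ F]
  {H : Type*} [TopologicalSpace H] (J : ModelWithCorners ℝ F H)
  {M : Type*} [TopologicalSpace M] [ChartedSpace H M]

/-- The tangent space at `x` of a submanifold `N` of `M`, as a subspace of `T_x M`: the span of the
velocities at `x` of the smooth curves of `M` that pass through `x` and stay in `N`. (For an
embedded submanifold these velocities already form a subspace, the tangent space.) -/
def tangentSub (N : Set M) (x : M) : Submodule ℝ (TangentSpace J x) :=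
  Submodule.span ℝ {X | ∃ c : ℝ → M, c 0 = x ∧ ContMDiffAt 𝓘(ℝ, ℝ) J ∞ c 0 ∧
    (∀ᶠ s in 𝓝 (0 : ℝ), c s ∈ N) ∧
    HasMFDerivAt 𝓘(ℝ, ℝ) J c 0 ((1 : ℝ →L[ℝ] ℝ).smulRight (show TangentSpace J (c 0) from X))}

/-- `w` is reached at time `t` from `x` along an integral curve of `Γ`, defined on an open interval
containing `0` and `t`, that stays in `N`. (For `N = univ` this is the usual flow on `M`; for a
submanifold `N` and a vector field `Γ` along and tangent to `N` it is the flow of `Γ` on `N`.) -/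
def FlowsTo (Γ : (x : M) → TangentSpace J x) (N : Set M) (t : ℝ) (x w : M) : Prop :=
  ∃ (a b : ℝ) (γ : ℝ → M), (0 : ℝ) ∈ Ioo a b ∧ t ∈ Ioo a b ∧ γ 0 = x ∧ γ t = w ∧
    (∀ s ∈ Ioo a b, γ s ∈ N) ∧ IsMIntegralCurveOn (I := J) γ Γ (Ioo a b)

open Classical in
/-- The flow `φ_t` of the vector field `Γ` on `N`, with the value `x` where it is not defined. -/
def flow (Γ : (x : M) → TangentSpace J x) (N : Set M) (t : ℝ) (x : M) : M :=
  if hx : ∃ w, FlowsTo J Γ N t x w then hx.choose else x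

/-- The set `M_h` of the points of `N` at which the flow of `Γ` on `N` is defined on `[0, h]`. -/
def flowDomain (Γ : (x : M) → TangentSpace J x) (N : Set M) (h : ℝ) : Set M :=
  {x | x ∈ N ∧ ∀ t ∈ Icc 0 h, ∃ w, FlowsTo J Γ N t x w}

end Tangent

section Mechanics

variable {E : Type*} [NormedAddCommGroup E] [NormedSpace ℝ E]
  {Q : Type*} [TopologicalSpace Q] [ChartedSpace E Q]

open Classical in
/-- The inverse, on the image of `V`, of a map `f : TQ → Q × Q` that is injective on `V`
(with the value `0_{q₀}` at the points `(q₀, q₁)` outside `f '' V`). -/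
def retraction (f : TB E Q → Q × Q) (V : Set (TB E Q)) (p : Q × Q) : TB E Q :=
  if hp : ∃ v ∈ V, f v = p then hp.choose else ⟨p.1, 0⟩

/-- A smooth distribution of constant rank `r`: it has a smooth frame of `r` vector fields near
every point. -/
def IsSmoothDistribution [IsManifold 𝓘(ℝ, E) ∞ Q] (D : (q : Q) → Submodule ℝ (Tan E q))
    (r : ℕ) : Prop :=
  ∀ q₀ : Q, ∃ O : Set Q, IsOpen O ∧ q₀ ∈ O ∧ ∃ X : Fin r → (q : Q) → Tan E q,
    (∀ i, ContMDiffOn 𝓘(ℝ, E) 𝓘(ℝ, E).tangent ∞ (fun q => (⟨q, X i q⟩ : TB E Q)) O) ∧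
    ∀ q ∈ O, LinearIndependent ℝ (fun i => X i q) ∧ Submodule.span ℝ (range fun i => X i q) = D q

/-- The distribution `D`, seen as a submanifold of `TQ`. -/
def distSet (D : (q : Q) → Submodule ℝ (Tan E q)) : Set (TB E Q) := {v | v.2 ∈ D v.proj}

/-- The vector `(X₀, X₁)` of `T_p (Q × Q) = T_{q₀} Q × T_{q₁} Q`, for `p = (q₀, q₁)`. -/
def pairVec (p : Q × Q) (X₀ : Tan E p.1) (X₁ : Tan E p.2) :
    TangentSpace (𝓘(ℝ, E).prod 𝓘(ℝ, E)) p :=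
  (X₀, X₁)

variable [IsManifold 𝓘(ℝ, E) ∞ Q]

/-- The exponential map at time `h` of a vector field `Γ` on `N ⊆ TQ`:
`v ↦ (τ v, τ (φ_h v))`. -/
def expMap (Γ : (v : TB E Q) → TTan v) (N : Set (TB E Q)) (h : ℝ) (v : TB E Q) : Q × Q :=
  (v.proj, (flow 𝓘(ℝ, E).tangent Γ N h v).proj)

/-- The tangent space `T_v D` of the submanifold `D` of `TQ`. -/
def tanDist (D : (q : Q) → Submodule ℝ (Tan E q)) (v : TB E Q) : Submodule ℝ (TTan v) :=
  tangentSub 𝓘(ℝ, E).tangent (distSet D) v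

/-- The annihilator `(T_v D)^o`. -/
def annTanDist (D : (q : Q) → Submodule ℝ (Tan E q)) (v : TB E Q) :
    Submodule ℝ (Module.Dual ℝ (TTan v)) :=
  (tanDist D v).dualAnnihilator

/-- The subspace `F_v^o = S^* ((T_v D)^o)` of `T_v^* (TQ)`. -/
def reactionForms (D : (q : Q) → Submodule ℝ (Tan E q)) (v : TB E Q) :
    Submodule ℝ (Module.Dual ℝ (TTan v)) :=
  (annTanDist D v).map (vertEndo v).toLinearMap.dualMap

/-- The admissibility condition `dim (T_v D)^o = dim F_v^o` for `v ∈ D`. -/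
def Admissible (D : (q : Q) → Submodule ℝ (Tan E q)) : Prop :=
  ∀ v ∈ distSet D, Module.finrank ℝ (annTanDist D v) = Module.finrank ℝ (reactionForms D v)

/-- The compatibility condition `T_v D ∩ ♯ (F_v^o) = 0` for `v ∈ D`, where `♯` is the inverse of
`Z ↦ i_Z ω_L`. -/
def Compatible (L : TB E Q → ℝ) (D : (q : Q) → Submodule ℝ (Tan E q)) : Prop :=
  ∀ v ∈ distSet D, ∀ Z ∈ tanDist D v,
    (contractOmega L v Z).toLinearMap ∈ reactionForms D v → Z = 0

/-- The nonholonomic vector field `Γ_nh` on `D`: the solution of `i_Γ ω_L - dE_L ∈ F^o`, `Γ ∈ TD`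
(unique for a regular nonholonomic system). Its values outside `D` are irrelevant. -/
def nhField (L : TB E Q → ℝ) (D : (q : Q) → Submodule ℝ (Tan E q)) (v : TB E Q) : TTan v :=
  Classical.epsilon fun Z : TTan v => Z ∈ tanDist D v ∧
    (contractOmega L v Z - diffTB (energy L) v).toLinearMap ∈ reactionForms D v

/-- The nonholonomic force `F_nh : D → T^*Q`: the covector for which the nonholonomic dynamics is
a forced one, `i_{Γ_nh} ω_L = dE_L - μ_{F_nh}`, on `D`. Its values outside `D` are irrelevant. -/
def nhForce (L : TB E Q → ℝ) (D : (q : Q) → Submodule ℝ (Tan E q)) : Force E Q := fun v =>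
  Classical.epsilon fun α : Tan E v.proj →L[ℝ] ℝ =>
    contractOmega L v (nhField L D v) = diffTB (energy L) v - semibasic v α

/-! Objects of the forced system `(L, F)`, with the exact retraction on `W`. -/

/-- `W` is a domain for the exact retraction of the forced system: an open set of tangent vectors on
which the exponential map at time `h` is defined and is a diffeomorphism onto an open set. -/
def IsRetractionDomain (L : TB E Q → ℝ) (F : Force E Q) (h : ℝ) (W : Set (TB E Q)) : Prop :=
  IsOpen W ∧ W ⊆ flowDomain 𝓘(ℝ, E).tangent (forcedField L F) univ h ∧
    InjOn (expMap (forcedField L F) univ h) W ∧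
    IsLocalDiffeomorphOn 𝓘(ℝ, E).tangent (𝓘(ℝ, E).prod 𝓘(ℝ, E)) ∞
      (expMap (forcedField L F) univ h) W

/-- `φ_t ∘ R^{e-}_{h,F}`, with the flow and the exact retraction of `Γ_(L,F)`. -/
def forcedCurve (L : TB E Q → ℝ) (F : Force E Q) (h : ℝ) (W : Set (TB E Q)) (t : ℝ) (p : Q × Q) :
    TB E Q :=
  flow 𝓘(ℝ, E).tangent (forcedField L F) univ t
    (retraction (expMap (forcedField L F) univ h) W p)

/-- The forced exact discrete Lagrangian `L^{e,h}_{d,F}`. -/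
def forcedDiscreteLagrangian (L : TB E Q → ℝ) (F : Force E Q) (h : ℝ) (W : Set (TB E Q))
    (p : Q × Q) : ℝ :=
  ∫ t in (0 : ℝ)..h, L (forcedCurve L F h W t p)

/-- The double exact discrete force `F_d^{e,h}`, evaluated on `(X₀, X₁)`: the integral of
`⟨F (φ_t (R p)), X₀₁ t⟩` with `X₀₁ t = T_p (τ ∘ φ_t ∘ R) (X₀, X₁)`. -/
def doubleDiscreteForce (L : TB E Q → ℝ) (F : Force E Q) (h : ℝ) (W : Set (TB E Q))
    (p : Q × Q) (X₀ : Tan E p.1) (X₁ : Tan E p.2) : ℝ :=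
  ∫ t in (0 : ℝ)..h, F (forcedCurve L F h W t p)
    (mfderiv (𝓘(ℝ, E).prod 𝓘(ℝ, E)) 𝓘(ℝ, E) (fun p' => (forcedCurve L F h W t p').proj) p
      (pairVec p X₀ X₁))

/-- The exact discrete force `F_d^{e,-}`. -/
def discreteForceMinus (L : TB E Q → ℝ) (F : Force E Q) (h : ℝ) (W : Set (TB E Q))
    (p : Q × Q) (X₀ : Tan E p.1) : ℝ :=
  doubleDiscreteForce L F h W p X₀ 0

/-- The exact discrete force `F_d^{e,+}`. -/
def discreteForcePlus (L : TB E Q → ℝ) (F : Force E Q) (h : ℝ) (W : Set (TB E Q))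
    (p : Q × Q) (X₁ : Tan E p.2) : ℝ :=
  doubleDiscreteForce L F h W p 0 X₁

/-! Objects of the nonholonomic system `(L, D)`, with the exact retraction on `U`. -/

/-- The nonholonomic exponential map. -/
def nhExp (L : TB E Q → ℝ) (D : (q : Q) → Submodule ℝ (Tan E q)) (h : ℝ) : TB E Q → Q × Q :=
  expMap (nhField L D) (distSet D) h

/-- The exact discrete nonholonomic constraint submanifold `M_h^{e,nh} = exp_h (U)`. -/
def discreteConstraint (L : TB E Q → ℝ) (D : (q : Q) → Submodule ℝ (Tan E q)) (h : ℝ)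
    (U : Set (TB E Q)) : Set (Q × Q) :=
  nhExp L D h '' U

/-- `φ_t ∘ R^{e-}_{h,nh}`, with the flow and the exact retraction of `Γ_nh`. -/
def nhCurve (L : TB E Q → ℝ) (D : (q : Q) → Submodule ℝ (Tan E q)) (h : ℝ) (U : Set (TB E Q))
    (t : ℝ) (p : Q × Q) : TB E Q :=
  flow 𝓘(ℝ, E).tangent (nhField L D) (distSet D) t (retraction (nhExp L D h) U p)

/-- The nonholonomic exact discrete Lagrangian `l^{e,h}_{d,nh}` on `M_h^{e,nh}`. -/
def nhDiscreteLagrangian (L : TB E Q → ℝ) (D : (q : Q) → Submodule ℝ (Tan E q)) (h : ℝ)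
    (U : Set (TB E Q)) (p : Q × Q) : ℝ :=
  ∫ t in (0 : ℝ)..h, L (nhCurve L D h U t p)

/-- The 1-form `β_nh` on `M_h^{e,nh}`, at `p`, evaluated on a vector `(X₀, X₁)` tangent to
`M_h^{e,nh}`: the integral of `⟨F_nh (γ₀ t), X₀₁ t⟩` with `X₀₁ t = T_p (τ ∘ φ_t ∘ R) (X₀, X₁)`, where
`τ ∘ φ_t ∘ R` is a map on `M_h^{e,nh}`. Its tangent map is the derivative within `M_h^{e,nh}`, which
is determined on the vectors tangent to `M_h^{e,nh}`. -/
def betaForm (L : TB E Q → ℝ) (D : (q : Q) → Submodule ℝ (Tan E q)) (h : ℝ)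
    (U : Set (TB E Q)) (p : Q × Q) (X₀ : Tan E p.1) (X₁ : Tan E p.2) : ℝ :=
  ∫ t in (0 : ℝ)..h, nhForce L D (nhCurve L D h U t p)
    (mfderivWithin (𝓘(ℝ, E).prod 𝓘(ℝ, E)) 𝓘(ℝ, E) (fun p' => (nhCurve L D h U t p').proj)
      (discreteConstraint L D h U) p
      (pairVec p X₀ X₁))

end Mechanics

end Nonholonomic

end

/-! The nonholonomic field solves the forced equation `i_Z ω_L = dE_L - μ_F` at every point of `D`,
for any extension `F` of the nonholonomic force. Since `L` is regular, `Z ↦ i_Z ω_L` is injective,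
so the two fields coincide on `D` (`forcedField_eq_nhField`). A nonholonomic integral curve stays in
`D`, hence is also an integral curve of the forced field. Uniqueness of integral curves then
identifies the flows, the exponential maps on `U`, the retractions on the discrete constraint set
and the trajectories `φ_t ∘ R` (`nhCurve_eq_forcedCurve`). Equality of the discrete Lagrangians
follows at once.

For the forces, `(X₀, X₁) = (X₀, 0) + (0, X₁)`, and linearity of the tangent map of `τ ∘ φ_t ∘ R`
gives the double discrete force as the sum of the two parts. On vectors tangent to the constraint
set the ambient tangent map agrees with the derivative within that set
(`mfderivWithin_apply_of_mem_tangentSub`), and `F` agrees with the nonholonomic force along the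
trajectory.

The analytic cost is that `τ ∘ φ_t ∘ R` must be differentiable and the integrands continuous in `t`,
so that the integrals add. This rests on differentiability of flows in the initial condition
(`mdifferentiableAt_flow`) and on smoothness of the forced field (`contMDiff_forcedField`), where
`ω_L` is inverted in charts of `TQ`. -/

noncomputable section

namespace Nonholonomic

/-! ### Differentiable dependence on initial conditions in a normed space -/

section LocalFlow

variable {F : Type*} [NormedAddCommGroup F] [NormedSpace ℝ F]

/-- A two-sided Grönwall estimate for a curve starting at the origin. -/
theorem norm_le_mul_exp_of_norm_deriv_le {u u' : ℝ → F} {K η ε : ℝ} (hK : 1 ≤ K) (hη : 0 ≤ η)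
    (h0 : u 0 = 0) (hu : ∀ t ∈ Ioo (-ε) ε, HasDerivAt u (u' t) t)
    (hb : ∀ t ∈ Ioo (-ε) ε, ‖u' t‖ ≤ K * ‖u t‖ + η) :
    ∀ t ∈ Ioo (-ε) ε, ‖u t‖ ≤ η * Real.exp (K * ε) := by
  have key : ∀ w w' : ℝ → F, w 0 = 0 → (∀ t ∈ Ioo (-ε) ε, HasDerivAt w (w' t) t) →
      (∀ t ∈ Ioo (-ε) ε, ‖w' t‖ ≤ K * ‖w t‖ + η) →
      ∀ t ∈ Ico 0 ε, ‖w t‖ ≤ η * Real.exp (K * ε) := by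
    intro w w' h0 hw hb t ht
    have hsub : Icc 0 t ⊆ Ioo (-ε) ε := fun s hs =>
      ⟨by linarith [hs.1, ht.1, ht.2], hs.2.trans_lt ht.2⟩
    have h := norm_le_gronwallBound_of_norm_deriv_right_le (f := w) (f' := w') (δ := 0) (K := K)
      (ε := η) (a := 0) (b := t)
      (fun s hs => (hw s (hsub hs)).continuousAt.continuousWithinAt)
      (fun s hs => (hw s (hsub (Ico_subset_Icc_self hs))).hasDerivWithinAt)
      (by simp [h0]) (fun s hs => hb s (hsub (Ico_subset_Icc_self hs))) t ⟨ht.1, le_rfl⟩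
    refine h.trans ?_
    rw [gronwallBound_of_K_ne_0 (by positivity), sub_zero]
    simp only [zero_mul, zero_add]
    -- The bound is `(η / K) (exp (K t) - 1)`; the assumption `1 ≤ K` absorbs the division.
    have h1 : Real.exp (K * t) ≤ Real.exp (K * ε) :=
      Real.exp_le_exp.2 (mul_le_mul_of_nonneg_left ht.2.le (by linarith))
    have h2 : 1 ≤ Real.exp (K * t) := Real.one_le_exp (mul_nonneg (by linarith) ht.1)
    exact mul_le_mul (div_le_self hη hK) (by linarith) (by linarith) hη
  intro t ht
  rcases le_total 0 t with h | h
  · exact key u u' h0 hu hb t ⟨h, ht.2⟩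
  -- Negative times follow by reversing time.
  · have := key (fun s => u (-s)) (fun s => -u' (-s)) (by simp [h0])
      (fun s hs => by
        have := (hu (-s) ⟨by linarith [hs.2], by linarith [hs.1]⟩).scomp s (hasDerivAt_neg s)
        simpa using! this)
      (fun s hs => by
        simpa using! hb (-s) ⟨by linarith [hs.2], by linarith [hs.1]⟩)
      (-t) ⟨by linarith, by linarith [ht.1]⟩
    simpa using this

/-- Quadratic bound for the Taylor remainder of a function with Lipschitz derivative. -/
theorem norm_sub_sub_le_of_lipschitz_fderiv {f : F → F} {s : Set F} {C : NNReal}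
    (hs : Convex ℝ s) (hd : ∀ x ∈ s, DifferentiableAt ℝ f x) (hC : LipschitzOnWith C (fderiv ℝ f) s)
    {x y : F} (hx : x ∈ s) (hy : y ∈ s) :
    ‖f y - f x - fderiv ℝ f x (y - x)‖ ≤ C * ‖y - x‖ ^ 2 := by
  have h := Convex.norm_image_sub_le_of_norm_hasFDerivWithin_le' (𝕜 := ℝ) (f := f)
    (s := segment ℝ x y) (C := C * ‖y - x‖) (f' := fderiv ℝ f) (φ := fderiv ℝ f x) (x := x) (y := y)
    (fun z hz => (hd z (hs.segment_subset hx hy hz)).hasFDerivAt.hasFDerivWithinAt)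
    (fun z hz => by
      refine (hC.norm_sub_le (hs.segment_subset hx hy hz) hx).trans ?_
      gcongr
      exact norm_sub_le_of_mem_segment hz)
    (convex_segment x y) (left_mem_segment ℝ x y) (right_mem_segment ℝ x y)
  rwa [mul_assoc, ← sq] at h

/-- The local flow of a `C^2` vector field is differentiable with respect to the initial condition,
and its derivative is continuous in time. -/
theorem exists_differentiable_localFlow [CompleteSpace F] {f : F → F} {x₀ : F}
    (hf : ContDiffAt ℝ 2 f x₀) {N : Set F} (hN : N ∈ 𝓝 x₀) :
    ∃ ε > (0 : ℝ), ∃ O ∈ 𝓝 x₀, ∃ (α : F → ℝ → F) (A : F → ℝ → F →L[ℝ] F), ∀ x ∈ O, α x 0 = x ∧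
      ∀ t ∈ Ioo (-ε) ε, α x t ∈ N ∧ HasDerivAt (α x) (f (α x t)) t ∧
        HasFDerivAt (fun y => α y t) (A x t) x ∧ ContinuousAt (A x) t := by
  have hf' : ContDiffAt ℝ 1 (fderiv ℝ f) x₀ := hf.fderiv_right (by norm_num [one_add_one_eq_two])
  let I₀ : F →L[ℝ] F := ContinuousLinearMap.id ℝ F
  -- The field coupled with its variational equation `A' = Df(α) A`, started at the identity. It is
  -- `C^1` because `f` is `C^2`, so Picard–Lindelöf produces the flow and the candidate `A` for its
  -- derivative together, both with Lipschitz dependence on the initial data.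
  let G : F × (F →L[ℝ] F) → F × (F →L[ℝ] F) := fun p => (f p.1, (fderiv ℝ f p.1).comp p.2)
  have hG : ContDiffAt ℝ 1 G (x₀, I₀) := by
    refine ContDiffAt.prodMk ?_ ?_
    · exact (hf.of_le (by norm_num)).comp (x₀, I₀) contDiffAt_fst
    · exact (ContDiffAt.comp (x₀, I₀) (g := fderiv ℝ f) hf' contDiffAt_fst).clm_comp contDiffAt_snd
  obtain ⟨ε, hε, a, r, L, K, hr, hpl⟩ := IsPicardLindelof.of_contDiffAt_one hG
  obtain ⟨β, hβ, L', hL'⟩ :=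
    (hpl 0).exists_forall_mem_closedBall_eq_hasDerivWithinAt_lipschitzOnWith
  obtain ⟨C, s, hs, hC⟩ := hf'.exists_lipschitzOnWith
  obtain ⟨K₁, hK₁⟩ : ∃ K₁, ∀ᶠ x in 𝓝 x₀, ‖fderiv ℝ f x‖ ≤ K₁ :=
    ⟨‖fderiv ℝ f x₀‖ + 1, (hf'.continuousAt.norm.eventually_le_const (by linarith))⟩
  have hdiff : ∀ᶠ x in 𝓝 x₀, DifferentiableAt ℝ f x :=
    (hf.eventually (by simp)).mono fun x hx => hx.differentiableAt (by norm_num)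
  obtain ⟨ρ, hρ, hball⟩ := Metric.mem_nhds_iff.1
    (inter_mem (inter_mem hN hs) (inter_mem hK₁ hdiff))
  have hmem : ∀ x ∈ Metric.closedBall x₀ (r : ℝ),
      (x, I₀) ∈ Metric.closedBall (x₀, I₀) (r : ℝ) := fun x hx => by
    simpa [Metric.mem_closedBall, Prod.dist_eq] using hx
  have hder : ∀ x ∈ Metric.closedBall x₀ (r : ℝ), ∀ t ∈ Ioo (-ε) ε,
      HasDerivAt (β (x, I₀)) (G (β (x, I₀) t)) t := fun x hx t ht =>
    ((hβ _ (hmem x hx)).2 t ⟨by linarith [ht.1], by linarith [ht.2]⟩).hasDerivAt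
      (Icc_mem_nhds (by linarith [ht.1]) (by linarith [ht.2]))
  let α : F → ℝ → F := fun x t => (β (x, I₀) t).1
  let A : F → ℝ → F →L[ℝ] F := fun x t => (β (x, I₀) t).2
  have hderα : ∀ x ∈ Metric.closedBall x₀ (r : ℝ), ∀ t ∈ Ioo (-ε) ε,
      HasDerivAt (α x) (f (α x t)) t := fun x hx t ht => (hder x hx t ht).fst
  have hderA : ∀ x ∈ Metric.closedBall x₀ (r : ℝ), ∀ t ∈ Ioo (-ε) ε,
      HasDerivAt (A x) ((fderiv ℝ f (α x t)).comp (A x t)) t := fun x hx t ht =>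
    (hder x hx t ht).snd
  have hx₀ : x₀ ∈ Metric.closedBall x₀ (r : ℝ) := Metric.mem_closedBall_self r.2
  have hLip : ∀ x ∈ Metric.closedBall x₀ (r : ℝ), ∀ y ∈ Metric.closedBall x₀ (r : ℝ),
      ∀ t ∈ Ioo (-ε) ε, ‖α y t - α x t‖ ≤ L' * ‖y - x‖ := by
    intro x hx y hy t ht
    have := (hL' t ⟨by linarith [ht.1], by linarith [ht.2]⟩).norm_sub_le (hmem y hy) (hmem x hx)
    refine (norm_fst_le _).trans (this.trans_eq ?_)
    simp
  have hcont : ContinuousAt (α x₀) 0 :=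
    (hder x₀ hx₀ 0 ⟨by linarith, hε⟩).continuousAt.fst
  have hα0 : ∀ x ∈ Metric.closedBall x₀ (r : ℝ), β (x, I₀) 0 = (x, I₀) := fun x hx =>
    (hβ _ (hmem x hx)).1
  have hev : ∀ᶠ t in 𝓝 (0 : ℝ), ‖α x₀ t - x₀‖ < ρ / 2 := by
    have : α x₀ 0 = x₀ := by simp [α, hα0 x₀ hx₀]
    have h1 : Tendsto (fun t => ‖α x₀ t - x₀‖) (𝓝 0) (𝓝 0) := by
      have := (hcont.sub (continuousAt_const (y := x₀))).norm
      simpa [ContinuousAt, ‹α x₀ 0 = x₀›] using this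
    exact h1.eventually_lt_const (by positivity)
  obtain ⟨ε₁, hε₁, hε₁'⟩ := Metric.eventually_nhds_iff.1 hev
  -- The base trajectory stays within `ρ / 2` of `x₀`, and nearby ones within `L' * ρ / (2 * (L' +
  -- 1)) ≤ ρ / 2` of it. All of them thus remain in the ball where the bounds on `f` hold; the `+ 1`
  -- covers `L' = 0`.
  refine ⟨min ε ε₁, lt_min hε hε₁, Metric.ball x₀ (min r (ρ / (2 * (L' + 1)))),
    Metric.ball_mem_nhds _ (lt_min (by exact_mod_cast hr) (by positivity)), α, A, ?_⟩
  set O := Metric.ball x₀ (min (r : ℝ) (ρ / (2 * (L' + 1)))) with hO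
  have hsubt : ∀ t ∈ Ioo (-min ε ε₁) (min ε ε₁), t ∈ Ioo (-ε) ε := fun t ht =>
    ⟨by linarith [ht.1, min_le_left ε ε₁], ht.2.trans_le (min_le_left _ _)⟩
  have hOr : ∀ x ∈ O, x ∈ Metric.closedBall x₀ (r : ℝ) := fun x hx =>
    Metric.mem_closedBall.2 ((Metric.mem_ball.1 hx).le.trans (min_le_left _ _))
  have hin : ∀ x ∈ O, ∀ t ∈ Ioo (-min ε ε₁) (min ε ε₁), α x t ∈ Metric.ball x₀ ρ := by
    intro x hx t ht
    have h1 := hLip x₀ hx₀ x (hOr x hx) t (hsubt t ht)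
    have h2 : ‖α x₀ t - x₀‖ < ρ / 2 := hε₁' (by
      rw [Real.dist_eq, sub_zero, abs_lt]
      exact ⟨by linarith [ht.1, min_le_right ε ε₁], ht.2.trans_le (min_le_right _ _)⟩)
    have h3 : ‖x - x₀‖ < ρ / (2 * (L' + 1)) := by
      rw [← dist_eq_norm]; exact (Metric.mem_ball.1 hx).trans_le (min_le_right _ _)
    have h4 : (L' : ℝ) * ‖x - x₀‖ ≤ ρ / 2 := by
      calc (L' : ℝ) * ‖x - x₀‖ ≤ (L' + 1) * (ρ / (2 * (L' + 1))) := by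
            gcongr; linarith
        _ = ρ / 2 := by field_simp
    rw [Metric.mem_ball, dist_eq_norm]
    calc ‖α x t - x₀‖ ≤ ‖α x t - α x₀ t‖ + ‖α x₀ t - x₀‖ := norm_sub_le_norm_sub_add_norm_sub ..
      _ < ρ := by linarith
  intro x hx
  refine ⟨by simp [α, hα0 x (hOr x hx)], fun t ht => ⟨(hball (hin x hx t ht)).1.1,
    hderα x (hOr x hx) t (hsubt t ht), ?_,
    (hderA x (hOr x hx) t (hsubt t ht)).continuousAt⟩⟩
  -- The remainder `u = α y - α x - A x (y - x)` satisfies `‖u'‖ ≤ K ‖u‖ + C (L' ‖y - x‖)²`, with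
  -- the quadratic term from Taylor's formula for `f`. Grönwall makes `u` quadratic in `y - x`, so
  -- `A x t` is the derivative.
  have hbound : ∀ y ∈ O, ‖α y t - α x t - A x t (y - x)‖ ≤
      (C * L' ^ 2 * Real.exp (max K₁ 1 * min ε ε₁)) * ‖y - x‖ ^ 2 := by
    intro y hy
    have := norm_le_mul_exp_of_norm_deriv_le (u := fun t => α y t - α x t - A x t (y - x))
      (u' := fun t => f (α y t) - f (α x t) - (fderiv ℝ f (α x t)).comp (A x t) (y - x))
      (K := max K₁ 1) (η := C * (L' * ‖y - x‖) ^ 2) (ε := min ε ε₁) (le_max_right _ _)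
      (by positivity) (by simp [α, A, hα0 x (hOr x hx), hα0 y (hOr y hy), I₀])
      (fun t ht => ((hderα y (hOr y hy) t (hsubt t ht)).sub
        (hderα x (hOr x hx) t (hsubt t ht))).sub
        (((hderA x (hOr x hx) t (hsubt t ht)).clm_apply (hasDerivAt_const t (y - x))).congr_deriv
          (by simp)))
      (fun t ht => by
        have hbx := hball (hin x hx t ht)
        have hT := norm_sub_sub_le_of_lipschitz_fderiv (convex_ball x₀ ρ)
          (fun z hz => (hball hz).2.2) (hC.mono fun z hz => (hball hz).1.2)
          (hin x hx t ht) (hin y hy t ht)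
        have hsplit : f (α y t) - f (α x t) - (fderiv ℝ f (α x t)).comp (A x t) (y - x) =
            fderiv ℝ f (α x t) (α y t - α x t - A x t (y - x)) +
              (f (α y t) - f (α x t) - fderiv ℝ f (α x t) (α y t - α x t)) := by
          simp only [ContinuousLinearMap.comp_apply, map_sub]; abel
        rw [hsplit]
        refine (norm_add_le _ _).trans (add_le_add ?_ (hT.trans ?_))
        · refine ((fderiv ℝ f (α x t)).le_opNorm _).trans ?_
          gcongr
          exact hbx.2.1.trans (le_max_left _ _)
        · gcongr
          exact hLip x (hOr x hx) y (hOr y hy) t (hsubt t ht)) t ht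
    refine this.trans_eq (by ring)
  have hO_nhds : O ∈ 𝓝 x := Metric.isOpen_ball.mem_nhds hx
  have h0 : HasFDerivAt (fun y => α y t - α x t - A x t (y - x)) (0 : F →L[ℝ] F) x := by
    refine Asymptotics.IsBigO.hasFDerivAt (n := 2) ?_ (by norm_num)
    refine Asymptotics.IsBigO.of_bound (C * L' ^ 2 * Real.exp (max K₁ 1 * min ε ε₁)) ?_
    filter_upwards [hO_nhds] with y hy
    simpa using hbound y hy
  have h1 : HasFDerivAt (fun y => A x t (y - x)) (A x t) x :=
    (A x t).hasFDerivAt.comp x ((hasFDerivAt_id x).sub_const x) |>.congr_fderiv (by ext; simp)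
  have h2 := (h0.add h1).add_const (α x t)
  simpa using! h2

end LocalFlow

/-! ### Local flows on a boundaryless manifold -/

section ManifoldLocalFlow

variable {F : Type*} [NormedAddCommGroup F] [NormedSpace ℝ F]
  {H : Type*} [TopologicalSpace H] {J : ModelWithCorners ℝ F H} [J.Boundaryless]
  {M : Type*} [TopologicalSpace M] [ChartedSpace H M] [IsManifold J ∞ M]

/-- The inverse of an extended chart maps an integral curve of the local representative of a vector
field to an integral curve of the vector field. -/
theorem hasMFDerivAt_extChartAt_symm_comp {V : (x : M) → TangentSpace J x} {z : M} {c : ℝ → F}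
    {t : ℝ} (hmem : c t ∈ (extChartAt J z).target)
    (hc : HasDerivAt c (tangentCoordChange J ((extChartAt J z).symm (c t)) z
      ((extChartAt J z).symm (c t)) (V ((extChartAt J z).symm (c t)))) t) :
    HasMFDerivAt 𝓘(ℝ, ℝ) J (fun s => (extChartAt J z).symm (c s)) t
      ((1 : ℝ →L[ℝ] ℝ).smulRight (V ((extChartAt J z).symm (c t)))) := by
  let xₜ : M := (extChartAt J z).symm (c t)
  have hft1 : xₜ ∈ (extChartAt J z).source := (extChartAt J z).map_target hmem
  have hft2 : xₜ ∈ (extChartAt J xₜ).source := mem_extChartAt_source (I := J) xₜ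
  -- `HasMFDerivAt` reads the curve in the preferred chart at its current point, whereas `c` lives
  -- in the chart at `z`. The velocity is carried across by the coordinate change; naming it as an
  -- element of `F` allows rewriting it freely.
  obtain ⟨w, hw⟩ : ∃ w : F, w = V xₜ := ⟨_, rfl⟩
  have hd : HasDerivAt ((extChartAt J xₜ ∘ (extChartAt J z).symm) ∘ c)
      w t := by
    rw [← tangentCoordChange_self (I := J) (x := xₜ) (z := xₜ) (v := w) hft2,
      ← tangentCoordChange_comp (x := z) ⟨⟨hft2, hft1⟩, hft2⟩]
    subst hw
    apply HasFDerivAt.comp_hasDerivAt _ _ hc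
    apply HasFDerivWithinAt.hasFDerivAt (s := range J) _ (by simp [J.range_eq_univ])
    rw [← (extChartAt J z).right_inv hmem]
    exact hasFDerivWithinAt_tangentCoordChange ⟨hft1, hft2⟩
  refine ⟨(continuousAt_extChartAt_symm'' hmem).comp hc.continuousAt, ?_⟩
  have hd' : HasFDerivAt ((extChartAt J xₜ ∘ (extChartAt J z).symm) ∘ c)
      ((1 : ℝ →L[ℝ] ℝ).smulRight w) t :=
    hd.hasFDerivAt.congr_fderiv (ContinuousLinearMap.ext_ring (by simp))
  subst hw
  exact hd'.hasFDerivWithinAt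

/-- The derivative of a map with values in a vector space, followed by the inverse of an extended
chart, is continuous in a parameter if the derivative of the map itself is. -/
theorem continuousOn_totalSpace_extChartAt_symm (z : M) {c B : ℝ → F} {s : Set ℝ}
    (hc : ContinuousOn c s) (hB : ContinuousOn B s) (hmem : ∀ t ∈ s, c t ∈ (extChartAt J z).target) :
    ContinuousOn (fun t => (⟨(extChartAt J z).symm (c t),
      mfderiv 𝓘(ℝ, F) J (extChartAt J z).symm (c t) (B t)⟩ : TangentBundle J M)) s := by
  have ho : IsOpen (extChartAt J z).target := isOpen_extChartAt_target z
  have h1 := (contMDiffOn_extChartAt_symm (I := J) (n := 1) z).continuousOn_tangentMapWithin le_rfl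
    ho.uniqueMDiffOn
  have h2 : ContinuousOn (fun t => (⟨c t, B t⟩ : TangentBundle 𝓘(ℝ, F) F)) s :=
    (tangentBundleModelSpaceHomeomorph 𝓘(ℝ, F)).symm.continuous.comp_continuousOn (hc.prodMk hB)
  refine (h1.comp h2 fun t ht => hmem t ht).congr fun t ht => ?_
  simp only [tangentMapWithin, Function.comp_apply]
  rw [mfderivWithin_of_mem_nhds (ho.mem_nhds (hmem t ht))]

/-- The local flow of a `C^2` vector field on a boundaryless manifold is differentiable with respect
to the initial condition, and its tangent map is continuous in time. -/
theorem exists_mdifferentiable_localFlow [CompleteSpace F] {V : (x : M) → TangentSpace J x} {z : M}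
    (hV : ContMDiffAt J J.tangent 2 (fun x => (⟨x, V x⟩ : TangentBundle J M)) z) :
    ∃ ε > (0 : ℝ), ∃ O ∈ 𝓝 z, ∃ ψ : ℝ → M → M, ∀ y ∈ O, ψ 0 y = y ∧
      IsMIntegralCurveOn (I := J) (fun t => ψ t y) V (Ioo (-ε) ε) ∧
      (∀ t ∈ Ioo (-ε) ε, MDifferentiableAt J J (ψ t) y) ∧
      ∀ Y : TangentSpace J y, ContinuousOn
        (fun t => (⟨ψ t y, mfderiv J J (ψ t) y Y⟩ : TangentBundle J M)) (Ioo (-ε) ε) := by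
  have hV' := (contMDiffAt_iff.1 hV).2.contDiffAt (by
    rw [J.range_eq_univ]; exact univ_mem)
  obtain ⟨ε, hε, O, hO, α, A, hα⟩ := exists_differentiable_localFlow hV'.snd
    (extChartAt_target_mem_nhds (I := J) z)
  let φ := extChartAt J z
  refine ⟨ε, hε, φ.source ∩ φ ⁻¹' O, inter_mem (extChartAt_source_mem_nhds z)
    ((continuousAt_extChartAt z).preimage_mem_nhds hO), fun t y => φ.symm (α (φ y) t), ?_⟩
  rintro y ⟨hy, hyO⟩
  have hy' : y ∈ (chartAt H z).source := by simpa [φ] using hy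
  have hcomp : ∀ t ∈ Ioo (-ε) ε, HasMFDerivAt J J (fun y => φ.symm (α (φ y) t)) y
      ((mfderiv 𝓘(ℝ, F) J φ.symm (α (φ y) t)).comp ((A (φ y) t).comp (mfderiv J 𝓘(ℝ, F) φ y))) := by
    intro t ht
    obtain ⟨hmem, -, hA, -⟩ := (hα _ hyO).2 t ht
    have h1 : MDifferentiableAt 𝓘(ℝ, F) J φ.symm (α (φ y) t) :=
      ((contMDiffOn_extChartAt_symm (I := J) (n := 1) z).mdifferentiableOn one_ne_zero
        _ hmem).mdifferentiableAt ((isOpen_extChartAt_target z).mem_nhds hmem)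
    have h2 : MDifferentiableAt J 𝓘(ℝ, F) φ y := mdifferentiableAt_extChartAt hy'
    exact h1.hasMFDerivAt.comp y (hA.hasMFDerivAt.comp y h2.hasMFDerivAt)
  refine ⟨?_, ?_, fun t ht => (hcomp t ht).mdifferentiableAt, fun Y => ?_⟩
  · simp only [(hα _ hyO).1]
    exact φ.left_inv hy
  · intro t ht
    obtain ⟨hmem, hd, -, -⟩ := (hα _ hyO).2 t ht
    exact (hasMFDerivAt_extChartAt_symm_comp hmem hd).hasMFDerivWithinAt
  · have := continuousOn_totalSpace_extChartAt_symm (J := J) z (s := Ioo (-ε) ε)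
      (c := fun t => α (φ y) t) (B := fun t => A (φ y) t (mfderiv J 𝓘(ℝ, F) φ y Y))
      (fun t ht => ((hα _ hyO).2 t ht).2.1.continuousAt.continuousWithinAt)
      (fun t ht => (((hα _ hyO).2 t ht).2.2.2.clm_apply continuousAt_const).continuousWithinAt)
      (fun t ht => ((hα _ hyO).2 t ht).1)
    refine this.congr fun t ht => ?_
    rw [(hcomp t ht).mfderiv]
    rfl

end ManifoldLocalFlow

/-! ### Uniqueness and differentiability of the flow over `[0, h]` -/

section GlobalFlow

variable {F : Type*} [NormedAddCommGroup F] [NormedSpace ℝ F]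
  {H : Type*} [TopologicalSpace H] {J : ModelWithCorners ℝ F H} [J.Boundaryless]
  {M : Type*} [TopologicalSpace M] [ChartedSpace H M] [IsManifold J ∞ M] [T2Space M]
  {V : (x : M) → TangentSpace J x}

theorem FlowsTo.unique (hV : ContMDiff J J.tangent 1 (fun x => (⟨x, V x⟩ : TangentBundle J M)))
    {t : ℝ} {x w w' : M} (h : FlowsTo J V univ t x w) (h' : FlowsTo J V univ t x w') : w = w' := by
  obtain ⟨a, b, γ, h0, ht, hγ0, rfl, -, hγ⟩ := h
  obtain ⟨a', b', γ', h0', ht', hγ0', rfl, -, hγ'⟩ := h'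
  refine isMIntegralCurveOn_Ioo_eqOn_of_contMDiff_boundaryless (t₀ := 0)
    (a := max a a') (b := min b b') ⟨max_lt h0.1 h0'.1, lt_min h0.2 h0'.2⟩ hV
    (hγ.mono (Ioo_subset_Ioo (le_max_left _ _) (min_le_left _ _)))
    (hγ'.mono (Ioo_subset_Ioo (le_max_right _ _) (min_le_right _ _))) (hγ0.trans hγ0'.symm)
    ⟨max_lt ht.1 ht'.1, lt_min ht.2 ht'.2⟩

theorem FlowsTo.flow_eq (hV : ContMDiff J J.tangent 1 (fun x => (⟨x, V x⟩ : TangentBundle J M)))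
    {t : ℝ} {x w : M} (h : FlowsTo J V univ t x w) : flow J V univ t x = w := by
  have hx : ∃ w, FlowsTo J V univ t x w := ⟨w, h⟩
  rw [flow, dif_pos hx]
  exact hx.choose_spec.unique hV h

theorem flow_zero (hV : ContMDiff J J.tangent 1 (fun x => (⟨x, V x⟩ : TangentBundle J M)))
    {h : ℝ} (hh : 0 ≤ h) {x : M} (hx : x ∈ flowDomain J V univ h) : flow J V univ 0 x = x := by
  obtain ⟨w, a, b, γ, h0, ht, hγ0, -, -, hγ⟩ := hx.2 0 ⟨le_rfl, hh⟩
  exact FlowsTo.flow_eq hV ⟨a, b, γ, h0, h0, hγ0, hγ0, fun _ _ => mem_univ _, hγ⟩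

/-- The value of `flow` is chosen separately at each time. The curve reaching time `h` already
covers `[0, h]`, and uniqueness forces all these choices onto it. -/
theorem exists_isMIntegralCurveOn_flow
    (hV : ContMDiff J J.tangent 1 (fun x => (⟨x, V x⟩ : TangentBundle J M)))
    {h : ℝ} (hh : 0 ≤ h) {x : M} (hx : x ∈ flowDomain J V univ h) :
    ∃ a < 0, ∃ b > h, ∃ γ : ℝ → M, IsMIntegralCurveOn (I := J) γ V (Ioo a b) ∧
      ∀ t ∈ Ioo a b, flow J V univ t x = γ t := by
  obtain ⟨w, a, b, γ, h0, ht, hγ0, -, -, hγ⟩ := hx.2 h ⟨hh, le_rfl⟩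
  exact ⟨a, h0.1, b, ht.2, γ, hγ, fun t ht =>
    FlowsTo.flow_eq hV ⟨a, b, γ, h0, ht, hγ0, rfl, fun _ _ => mem_univ _, hγ⟩⟩

/-- A group law for short times: translated by `s`, the curve `c` meets the trajectory of `y` at
time `s`, so the two agree wherever both are defined. It lets the flow be continued by local flows.
-/
theorem flow_eq_of_isMIntegralCurveOn
    (hV : ContMDiff J J.tangent 1 (fun x => (⟨x, V x⟩ : TangentBundle J M)))
    {h : ℝ} (hh : 0 ≤ h) {y : M} (hy : y ∈ flowDomain J V univ h) {s t ε : ℝ} (hs : s ∈ Icc 0 h)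
    (ht : t ∈ Icc 0 h) {c : ℝ → M} (hc0 : c 0 = flow J V univ s y)
    (hc : IsMIntegralCurveOn (I := J) c V (Ioo (-ε) ε)) (hst : |t - s| < ε) :
    flow J V univ t y = c (t - s) := by
  obtain ⟨a, ha, b, hb, γ, hγ, heq⟩ := exists_isMIntegralCurveOn_flow hV hh hy
  have hε : 0 < ε := (abs_nonneg _).trans_lt hst
  obtain ⟨h1, h2⟩ := abs_lt.1 hst
  have hc' : IsMIntegralCurveOn (I := J) (c ∘ (· + -s)) V (Ioo (s - ε) (s + ε)) := by
    refine (hc.comp_add (-s)).mono fun r hr => ?_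
    exact ⟨by linarith [hr.1], by linarith [hr.2]⟩
  have := isMIntegralCurveOn_Ioo_eqOn_of_contMDiff_boundaryless (t₀ := s)
    (a := max a (s - ε)) (b := min b (s + ε))
    ⟨max_lt (by linarith [hs.1]) (by linarith), lt_min (by linarith [hs.2]) (by linarith)⟩ hV
    (hγ.mono (Ioo_subset_Ioo (le_max_left _ _) (min_le_left _ _)))
    (hc'.mono (Ioo_subset_Ioo (le_max_right _ _) (min_le_right _ _))) (by simp [hc0, ← heq s ⟨ha.trans_le hs.1, hs.2.trans_lt hb⟩])
    (x := t) ⟨max_lt (by linarith [ht.1]) (by linarith), lt_min (by linarith [ht.2]) (by linarith)⟩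
  rw [heq t ⟨ha.trans_le ht.1, ht.2.trans_lt hb⟩, this]
  simp [sub_eq_add_neg]

variable [CompleteSpace F]

/-- The flow of a `C^2` vector field is differentiable at the interior points of its domain, and its
tangent map is continuous in time. -/
theorem mdifferentiableAt_flow
    (hV : ContMDiff J J.tangent 2 (fun x => (⟨x, V x⟩ : TangentBundle J M)))
    {h : ℝ} (hh : 0 ≤ h) {x : M} (hx : flowDomain J V univ h ∈ 𝓝 x) :
    (∀ t ∈ Icc 0 h, MDifferentiableAt J J (flow J V univ t) x) ∧
    ∀ X : TangentSpace J x, ContinuousOn (fun t => (⟨flow J V univ t x,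
      mfderiv J J (flow J V univ t) x X⟩ : TangentBundle J M)) (Icc 0 h) := by
  have hV1 := hV.of_le (m := 1) (by norm_num)
  have hxd := mem_of_mem_nhds hx
  obtain ⟨a, ha, b, hb, γ, hγ, heq⟩ := exists_isMIntegralCurveOn_flow hV1 hh hxd
  have hcont : ∀ s ∈ Icc 0 h, ContinuousAt (fun t => flow J V univ t x) s := fun s hs =>
    (((hγ.continuousOn).congr heq) s ⟨by linarith [hs.1], by linarith [hs.2]⟩).continuousAt
      (Ioo_mem_nhds (by linarith [hs.1]) (by linarith [hs.2]))
  have hD : ∀ t ∈ Icc 0 h, MDifferentiableAt J J (flow J V univ t) x := by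
    have hD0 : MDifferentiableAt J J (flow J V univ 0) x :=
      mdifferentiableAt_id.congr_of_eventuallyEq
        (mem_of_superset hx fun y hy => flow_zero hV1 hh hy)
    intro t ht
    -- Differentiability at time `s` passes to all nearby times and back, by composition with a
    -- local flow around the trajectory. Connectedness of `[0, h]` spreads it from time `0`, where
    -- the flow is the identity near `x`.
    refine (isPreconnected_Icc.induction₂ (s := Icc 0 h) (fun s t =>
      MDifferentiableAt J J (flow J V univ s) x ↔ MDifferentiableAt J J (flow J V univ t) x)
      ?_ (fun _ _ _ _ _ _ h₁ h₂ => h₁.trans h₂) (fun _ _ _ _ h => h.symm)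
      (left_mem_Icc.2 hh) ht).1 hD0
    intro s hs
    obtain ⟨ε, hε, O, hO, ψ, hψ⟩ := exists_mdifferentiable_localFlow (hV (flow J V univ s x))
    have step : ∀ s₁ ∈ Icc 0 h, ∀ s₂ ∈ Icc 0 h, |s₂ - s₁| < ε → O ∈ 𝓝 (flow J V univ s₁ x) →
        MDifferentiableAt J J (flow J V univ s₁) x → MDifferentiableAt J J (flow J V univ s₂) x := by
      intro s₁ hs₁ s₂ hs₂ h12 hO₁ hd
      have hev : flow J V univ s₂ =ᶠ[𝓝 x] ψ (s₂ - s₁) ∘ flow J V univ s₁ := by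
        filter_upwards [hx, hd.continuousAt.preimage_mem_nhds hO₁] with y hy hyO
        exact flow_eq_of_isMIntegralCurveOn hV1 hh hy hs₁ hs₂ (hψ _ hyO).1 (hψ _ hyO).2.1 h12
      exact (((hψ _ (mem_of_mem_nhds hO₁)).2.2.1 _ (abs_lt.1 h12)).comp x hd).congr_of_eventuallyEq
        hev
    have h1 : ∀ᶠ t in 𝓝 s, O ∈ 𝓝 (flow J V univ t x) :=
      (hcont s hs).eventually (eventually_mem_nhds_iff.2 hO)
    have h2 : ∀ᶠ t in 𝓝 s, |t - s| < ε := Metric.ball_mem_nhds s hε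
    filter_upwards [self_mem_nhdsWithin, nhdsWithin_le_nhds h1, nhdsWithin_le_nhds h2] with t ht h1 h2
    exact ⟨step s hs t ht h2 hO, step t ht s hs (by rwa [abs_sub_comm]) h1⟩
  refine ⟨hD, fun X s hs => ?_⟩
  obtain ⟨ε, hε, O, hO, ψ, hψ⟩ := exists_mdifferentiable_localFlow (hV (flow J V univ s x))
  obtain ⟨-, -, hψd, hψc⟩ := hψ _ (mem_of_mem_nhds hO)
  -- Near `x` the flow at time `t` is `ψ (t - s)` after the flow at time `s`, so continuity in `t`
  -- at `s` reduces to that of the tangent map of `ψ` at time `0`.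
  have hc := (hψc (mfderiv J J (flow J V univ s) x X)).continuousAt
    (Ioo_mem_nhds (by linarith) hε)
  have hc' : ContinuousAt (fun t => (⟨ψ (t - s) (flow J V univ s x),
      mfderiv J J (ψ (t - s)) (flow J V univ s x) (mfderiv J J (flow J V univ s) x X)⟩ :
        TangentBundle J M)) s := by
    rw [← sub_self s] at hc
    exact ContinuousAt.comp (f := fun t => t - s) (x := s) hc (by fun_prop)
  have h2 : ∀ᶠ t in 𝓝 s, |t - s| < ε := Metric.ball_mem_nhds s hε
  have key : ∀ t ∈ Icc 0 h, |t - s| < ε → (⟨flow J V univ t x,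
      mfderiv J J (flow J V univ t) x X⟩ : TangentBundle J M) = ⟨ψ (t - s) (flow J V univ s x),
      mfderiv J J (ψ (t - s)) (flow J V univ s x) (mfderiv J J (flow J V univ s) x X)⟩ := by
    intro t ht hts
    have hev : flow J V univ t =ᶠ[𝓝 x] ψ (t - s) ∘ flow J V univ s := by
      filter_upwards [hx, (hD s hs).continuousAt.preimage_mem_nhds hO] with y hy hyO
      exact flow_eq_of_isMIntegralCurveOn hV1 hh hy hs ht (hψ _ hyO).1 (hψ _ hyO).2.1 hts
    have hm := (((hψd _ (abs_lt.1 hts)).hasMFDerivAt.comp x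
      (hD s hs).hasMFDerivAt).congr_of_eventuallyEq hev).mfderiv
    exact congrArg₂ (fun (p : M) (v : F) => (⟨p, v⟩ : TangentBundle J M)) hev.eq_of_nhds
      (DFunLike.congr_fun hm X)
  refine hc'.continuousWithinAt.congr_of_eventuallyEq ?_ (key s hs (by simpa using hε))
  filter_upwards [self_mem_nhdsWithin, nhdsWithin_le_nhds h2] with t ht h2
  exact key t ht h2

end GlobalFlow

/-! ### Charts of `TQ`, the projection and the vertical lift -/

section TangentBundleCharts

variable {E : Type*} [NormedAddCommGroup E] [NormedSpace ℝ E]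
  {Q : Type*} [TopologicalSpace Q] [ChartedSpace E Q] [IsManifold 𝓘(ℝ, E) ∞ Q]

instance [T2Space Q] : T2Space (TB E Q) := by
  refine ⟨fun v w hvw => ?_⟩
  -- Vectors over one base point lie in a common chart domain of `TQ`; otherwise disjoint open sets
  -- are pulled back from `Q`.
  by_cases hp : v.proj = w.proj
  · have hv : v ∈ (extChartAt 𝓘(ℝ, E).tangent v).source := mem_extChartAt_source v
    have hw : w ∈ (extChartAt 𝓘(ℝ, E).tangent v).source := by
      simp [← hp]
    obtain ⟨A, B, hA, hB, hvA, hwB, hAB⟩ := t2_separation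
      (fun h => hvw ((extChartAt 𝓘(ℝ, E).tangent v).injOn hv hw h))
    have ho := isOpen_extChartAt_source (I := 𝓘(ℝ, E).tangent) v
    have hc := continuousOn_extChartAt (I := 𝓘(ℝ, E).tangent) v
    exact ⟨_, _, hc.isOpen_inter_preimage ho hA, hc.isOpen_inter_preimage ho hB, ⟨hv, hvA⟩,
      ⟨hw, hwB⟩, (hAB.preimage _).mono inter_subset_right inter_subset_right⟩
  · obtain ⟨A, B, hA, hB, hvA, hwB, hAB⟩ := t2_separation hp
    have hc : Continuous (Bundle.TotalSpace.proj : TB E Q → Q) :=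
      FiberBundle.continuous_proj E (TangentSpace 𝓘(ℝ, E))
    exact ⟨_, _, hA.preimage hc, hB.preimage hc, hvA, hwB, hAB.preimage _⟩

/-- The chart of `TQ` at `v`. -/
abbrev tbChart (v : TB E Q) : PartialEquiv (TB E Q) (E × E) := extChartAt 𝓘(ℝ, E).tangent v

theorem mem_tbChart_target {v : TB E Q} {x : E × E} :
    x ∈ (tbChart v).target ↔ x.1 ∈ (extChartAt 𝓘(ℝ, E) v.proj).target := by
  simp only [tbChart, extChartAt, OpenPartialHomeomorph.extend, mfld_simps]
  exact TangentBundle.mem_chart_target_iff (I := 𝓘(ℝ, E)) x v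

theorem tbChart_symm_apply {v : TB E Q} {x : E × E} (hx : x ∈ (tbChart v).target) :
    (tbChart v).symm x = ⟨(extChartAt 𝓘(ℝ, E) v.proj).symm x.1,
      mfderiv 𝓘(ℝ, E) 𝓘(ℝ, E) (extChartAt 𝓘(ℝ, E) v.proj).symm x.1 x.2⟩ := by
  have h := tangentMap_chart_symm (I := 𝓘(ℝ, E)) (p := v) (q := (⟨x.1, x.2⟩ : TB E E))
    (by simpa [extChartAt, OpenPartialHomeomorph.extend] using mem_tbChart_target.1 hx)
  exact h.symm

theorem isOpen_tbChart_target (v : TB E Q) : IsOpen (tbChart v).target :=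
  isOpen_extChartAt_target v

theorem contMDiffAt_tbChart_symm {v : TB E Q} {x : E × E} (hx : x ∈ (tbChart v).target) :
    ContMDiffAt 𝓘(ℝ, E × E) 𝓘(ℝ, E).tangent ∞ (tbChart v).symm x :=
  (contMDiffOn_extChartAt_symm v).contMDiffAt ((isOpen_tbChart_target v).mem_nhds hx)

theorem contMDiffAt_tbChart {v u : TB E Q} (hu : u ∈ (tbChart v).source) :
    ContMDiffAt 𝓘(ℝ, E).tangent 𝓘(ℝ, E × E) ∞ (tbChart v) u :=
  contMDiffAt_extChartAt' (by simpa only [tbChart, extChartAt_source] using hu)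

theorem contMDiffAt_extChartAt_symm {q : Q} {y : E} (hy : y ∈ (extChartAt 𝓘(ℝ, E) q).target) :
    ContMDiffAt 𝓘(ℝ, E) 𝓘(ℝ, E) ∞ (extChartAt 𝓘(ℝ, E) q).symm y :=
  (contMDiffOn_extChartAt_symm q).contMDiffAt ((isOpen_extChartAt_target q).mem_nhds hy)

theorem mdifferentiableAt_proj (u : TB E Q) :
    MDifferentiableAt 𝓘(ℝ, E).tangent 𝓘(ℝ, E) (fun u : TB E Q => u.proj) u :=
  (Bundle.contMDiff_proj (TangentSpace 𝓘(ℝ, E)) (n := 1)).mdifferentiableAt one_ne_zero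

/-- The inclusion of a fibre of `TQ` is smooth. -/
theorem contMDiff_fibre (q : Q) :
    ContMDiff 𝓘(ℝ, E) 𝓘(ℝ, E).tangent ∞ (fun w : E => (⟨q, w⟩ : TB E Q)) := by
  intro w
  rw [Bundle.contMDiffAt_totalSpace]
  refine ⟨contMDiffAt_const, ?_⟩
  have h : ContMDiff 𝓘(ℝ, E) 𝓘(ℝ, E) ∞ (tangentCoordChange 𝓘(ℝ, E) q q q) :=
    (tangentCoordChange 𝓘(ℝ, E) q q q).contDiff.contMDiff
  exact h w

theorem tanProj_comp_mfderiv_tbChart_symm {v : TB E Q} {x : E × E} (hx : x ∈ (tbChart v).target) :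
    (tanProj ((tbChart v).symm x)).comp
        (mfderiv 𝓘(ℝ, E × E) 𝓘(ℝ, E).tangent (tbChart v).symm x) =
      (show E →L[ℝ] E from mfderiv 𝓘(ℝ, E) 𝓘(ℝ, E) (extChartAt 𝓘(ℝ, E) v.proj).symm x.1).comp
        (ContinuousLinearMap.fst ℝ E E) := by
  have h1 := ((mdifferentiableAt_proj ((tbChart v).symm x)).hasMFDerivAt.comp x
    ((contMDiffAt_tbChart_symm hx).mdifferentiableAt (by simp)).hasMFDerivAt).mfderiv
  have h2 := (((contMDiffAt_extChartAt_symm (mem_tbChart_target.1 hx)).mdifferentiableAt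
    (by simp)).hasMFDerivAt.comp x
      (hasFDerivAt_fst (𝕜 := ℝ) (E := E) (F := E) (p := x)).hasMFDerivAt).mfderiv
  exact h1.symm.trans h2

theorem vertLift_mfderiv_extChartAt_symm {v : TB E Q} {x : E × E} (hx : x ∈ (tbChart v).target)
    (a : E) :
    vertLift ((tbChart v).symm x)
        (mfderiv 𝓘(ℝ, E) 𝓘(ℝ, E) (extChartAt 𝓘(ℝ, E) v.proj).symm x.1 a) =
      mfderiv 𝓘(ℝ, E × E) 𝓘(ℝ, E).tangent (tbChart v).symm x ((0, a) : E × E) := by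
  let T : E →L[ℝ] E := mfderiv 𝓘(ℝ, E) 𝓘(ℝ, E) (extChartAt 𝓘(ℝ, E) v.proj).symm x.1
  let q := (extChartAt 𝓘(ℝ, E) v.proj).symm x.1
  -- The chart of `TQ` is linear on fibres: moving in the second coordinate is moving in the fibre
  -- through the linear map `T`. Differentiating both sides gives the claim.
  have hfun : (fun w : E => (⟨q, w⟩ : TB E Q)) ∘ T = (tbChart v).symm ∘ fun w : E => (x.1, w) := by
    ext1 w
    exact (tbChart_symm_apply (x := (x.1, w)) (mem_tbChart_target.2 (mem_tbChart_target.1 hx))).symm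
  have h1 := ((((contMDiff_fibre (E := E) q) (T x.2)).mdifferentiableAt (by simp)).hasMFDerivAt.comp
    x.2 T.hasFDerivAt.hasMFDerivAt).mfderiv
  have h2 := (HasMFDerivAt.comp x.2 (f := fun w : E => (x.1, w)) (g := (tbChart v).symm)
    ((contMDiffAt_tbChart_symm (x := (x.1, x.2)) hx).mdifferentiableAt (by simp)).hasMFDerivAt
    (hasFDerivAt_prodMk_right (𝕜 := ℝ) x.1 x.2).hasMFDerivAt).mfderiv
  have h3 : (tbChart v).symm x = ⟨q, T x.2⟩ := tbChart_symm_apply hx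
  rw [hfun, h2] at h1
  have h4 := DFunLike.congr_fun h1 a
  have h5 : (show E from ((tbChart v).symm x).2) = T x.2 :=
    congrArg (fun p : TB E Q => (show E from p.2)) h3
  change (mfderiv 𝓘(ℝ, E) 𝓘(ℝ, E).tangent (fun w : E => (⟨q, w⟩ : TB E Q))
    (show E from ((tbChart v).symm x).2)) (T a) = _
  rw [h5]
  exact h4.symm.trans rfl

end TangentBundleCharts

/-! ### Local expressions of forms and independence of the chart -/

section LocalRepresentatives

variable {E : Type*} [NormedAddCommGroup E] [NormedSpace ℝ E]
  {Q : Type*} [TopologicalSpace Q] [ChartedSpace E Q] [IsManifold 𝓘(ℝ, E) ∞ Q]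

/-- The derivative of the chart of `TQ` at `v`, evaluated at `u`. -/
def tbChartDeriv (v u : TB E Q) : E × E →L[ℝ] E × E :=
  mfderiv 𝓘(ℝ, E).tangent 𝓘(ℝ, E × E) (tbChart v) u

/-- The representative of a 1-form on `TQ` in the chart at `v`. -/
def localForm (θ : (v : TB E Q) → TTan v →L[ℝ] ℝ) (v : TB E Q) (x : E × E) : E × E →L[ℝ] ℝ :=
  (θ ((tbChart v).symm x)).comp (mfderiv 𝓘(ℝ, E × E) 𝓘(ℝ, E).tangent (tbChart v).symm x)

theorem diffTB_mfderiv_tbChart_symm {f : TB E Q → ℝ} {v : TB E Q} {x : E × E}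
    (hx : x ∈ (tbChart v).target)
    (hf : MDifferentiableAt 𝓘(ℝ, E).tangent 𝓘(ℝ, ℝ) f ((tbChart v).symm x)) (y : E × E) :
    diffTB f ((tbChart v).symm x) (mfderiv 𝓘(ℝ, E × E) 𝓘(ℝ, E).tangent (tbChart v).symm x y) =
      fderiv ℝ (f ∘ (tbChart v).symm) x y := by
  have h := (hf.hasMFDerivAt.comp x
    ((contMDiffAt_tbChart_symm hx).mdifferentiableAt (by simp)).hasMFDerivAt).mfderiv
  rw [mfderiv_eq_fderiv] at h
  exact (DFunLike.congr_fun h y).symm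

/-- In bundle coordinates the vertical endomorphism is `(a, b) ↦ (0, a)`, by the two preceding
formulas for the projection and the vertical lift. -/
theorem localForm_cartanOneForm {L : TB E Q → ℝ} {v : TB E Q} {x : E × E}
    (hx : x ∈ (tbChart v).target)
    (hL : MDifferentiableAt 𝓘(ℝ, E).tangent 𝓘(ℝ, ℝ) L ((tbChart v).symm x)) :
    localForm (cartanOneForm L) v x = (fderiv ℝ (L ∘ (tbChart v).symm) x).comp
      ((ContinuousLinearMap.inr ℝ E E).comp (ContinuousLinearMap.fst ℝ E E)) := by
  refine ContinuousLinearMap.ext fun y => ?_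
  have h1 := DFunLike.congr_fun (tanProj_comp_mfderiv_tbChart_symm hx) y
  have h2 := vertLift_mfderiv_extChartAt_symm hx y.1
  have h3 := diffTB_mfderiv_tbChart_symm hx hL ((0, y.1) : E × E)
  refine Eq.trans ?_ h3
  exact congrArg (diffTB L ((tbChart v).symm x))
    ((congrArg (vertLift ((tbChart v).symm x)) h1).trans h2)

/-- `extDerivTB` uses a different chart at each point, while smoothness in `v` requires a fixed one.
Under a change of chart `ψ` the extra term is `θ' (D²ψ (·, ·))`, which antisymmetrization removes.
-/
theorem extDerivTB_apply (θ : (v : TB E Q) → TTan v →L[ℝ] ℝ) {v₀ v : TB E Q}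
    (hv : v ∈ (tbChart v₀).source) (hθ : DifferentiableAt ℝ (localForm θ v₀) (tbChart v₀ v))
    (Z Y : TTan v) :
    extDerivTB θ v Z Y =
      fderiv ℝ (localForm θ v₀) (tbChart v₀ v) (tbChartDeriv v₀ v Z) (tbChartDeriv v₀ v Y) -
      fderiv ℝ (localForm θ v₀) (tbChart v₀ v) (tbChartDeriv v₀ v Y) (tbChartDeriv v₀ v Z) := by
  let xv := tbChart v v
  have hxv : xv ∈ (tbChart v).target := mem_extChartAt_target v
  have hvv : v ∈ (tbChart v).source := mem_extChartAt_source v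
  have hsymm : (tbChart v).symm xv = v := (tbChart v).left_inv hvv
  let ψ : E × E → E × E := tbChart v₀ ∘ (tbChart v).symm
  have hψxv : ψ xv = tbChart v₀ v := congrArg (tbChart v₀) hsymm
  have hψ : ∀ x ∈ (tbChart v).target, (tbChart v).symm x ∈ (tbChart v₀).source →
      ContDiffAt ℝ ∞ ψ x := fun x hx hx' =>
    ((contMDiffAt_tbChart hx').comp x (contMDiffAt_tbChart_symm hx)).contDiffAt
  have hO : (tbChart v).target ∩ (tbChart v).symm ⁻¹' (tbChart v₀).source ∈ 𝓝 xv := by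
    refine inter_mem ((isOpen_tbChart_target v).mem_nhds hxv)
      ((contMDiffAt_tbChart_symm hxv).continuousAt.preimage_mem_nhds ?_)
    rw [hsymm]
    exact (isOpen_extChartAt_source v₀).mem_nhds hv
  have hform : localForm θ v =ᶠ[𝓝 xv] fun x => (localForm θ v₀ (ψ x)).comp (fderiv ℝ ψ x) := by
    filter_upwards [eventually_mem_nhds_iff.2 hO] with x hx'
    obtain ⟨hx, hxs⟩ := mem_of_mem_nhds hx'
    have htgt : ψ x ∈ (tbChart v₀).target := (tbChart v₀).map_source hxs
    have hpt : (tbChart v₀).symm (ψ x) = (tbChart v).symm x := (tbChart v₀).left_inv hxs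
    have hev : (tbChart v).symm =ᶠ[𝓝 x] (tbChart v₀).symm ∘ ψ := by
      filter_upwards [hx'] with y hy
      exact ((tbChart v₀).left_inv hy.2).symm
    have hD := ((((contMDiffAt_tbChart_symm htgt).mdifferentiableAt (by simp)).hasMFDerivAt.comp x
      ((hψ x hx hxs).differentiableAt (by simp)).hasFDerivAt.hasMFDerivAt).congr_of_eventuallyEq
      hev).mfderiv
    -- Forgetting that the tangent space depends on the point makes it possible to rewrite along
    -- `hpt`.
    let θ' : TB E Q → E × E →L[ℝ] ℝ := θ
    have hθ' : θ' ((tbChart v).symm x) = θ' ((tbChart v₀).symm (ψ x)) := by rw [hpt]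
    have h1 : localForm θ v x = (θ' ((tbChart v).symm x)).comp
      (show E × E →L[ℝ] E × E from mfderiv 𝓘(ℝ, E × E) 𝓘(ℝ, E).tangent (tbChart v).symm x) := rfl
    rw [h1, hD, hθ']
    rfl
  have hder : HasFDerivAt (localForm θ v₀) (fderiv ℝ (localForm θ v₀) (tbChart v₀ v)) (ψ xv) := by
    rw [hψxv]; exact hθ.hasFDerivAt
  have hψ' : ContDiffAt ℝ ∞ ψ xv := hψ xv hxv (by rw [hsymm]; exact hv)
  have hψ2 : HasFDerivAt (fderiv ℝ ψ) (fderiv ℝ (fderiv ℝ ψ) xv) xv :=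
    ((hψ'.fderiv_right (m := ∞) (by simp)).differentiableAt (by simp)).hasFDerivAt
  have hA := (((hder.comp xv (hψ'.differentiableAt (by simp)).hasFDerivAt).clm_comp
    hψ2).congr_of_eventuallyEq hform).fderiv
  have hP : tbChartDeriv v₀ v = (fderiv ℝ ψ xv).comp (tbChartDeriv v v) := by
    have hev : tbChart v₀ =ᶠ[𝓝 v] ψ ∘ tbChart v := by
      filter_upwards [(isOpen_extChartAt_source (I := 𝓘(ℝ, E).tangent) v).mem_nhds hvv] with u hu
      exact congrArg (tbChart v₀) ((tbChart v).left_inv hu).symm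
    exact (((hψ'.differentiableAt (by simp)).hasFDerivAt.hasMFDerivAt.comp v
      ((contMDiffAt_tbChart hvv).mdifferentiableAt (by simp)).hasMFDerivAt).congr_of_eventuallyEq
      hev).mfderiv
  have hsym : ∀ a b, fderiv ℝ (fderiv ℝ ψ) xv a b = fderiv ℝ (fderiv ℝ ψ) xv b a :=
    hψ'.isSymmSndFDerivAt (by simpa using ENat.LEInfty.out)
  have h0 : extDerivTB θ v Z Y =
      fderiv ℝ (localForm θ v) xv (tbChartDeriv v v Z) (tbChartDeriv v v Y) -
      fderiv ℝ (localForm θ v) xv (tbChartDeriv v v Y) (tbChartDeriv v v Z) := rfl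
  have hPa : ∀ a : TTan v, tbChartDeriv v₀ v a = fderiv ℝ ψ xv (tbChartDeriv v v a) :=
    fun a => DFunLike.congr_fun hP a
  rw [h0, hA, hPa, hPa]
  simp [hsym (tbChartDeriv v v Y) (tbChartDeriv v v Z)]

end LocalRepresentatives

/-! ### The Poincaré–Cartan form in coordinates and its nondegeneracy -/

section ForcedField

variable {E : Type*} [NormedAddCommGroup E] [NormedSpace ℝ E]
  {Q : Type*} [TopologicalSpace Q] [ChartedSpace E Q] [IsManifold 𝓘(ℝ, E) ∞ Q]

theorem contDiffAt_comp_tbChart_symm {G : Type*} [NormedAddCommGroup G] [NormedSpace ℝ G]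
    {f : TB E Q → G} (hf : ContMDiff 𝓘(ℝ, E).tangent 𝓘(ℝ, G) ∞ f) {v : TB E Q} {x : E × E}
    (hx : x ∈ (tbChart v).target) : ContDiffAt ℝ ∞ (f ∘ (tbChart v).symm) x :=
  ((hf _).comp x (contMDiffAt_tbChart_symm hx)).contDiffAt

theorem tbChart_symm_mem_source {v : TB E Q} {x : E × E} (hx : x ∈ (tbChart v).target) :
    (tbChart v).symm x ∈ (tbChart v).source := (tbChart v).map_target hx

theorem tbChartDeriv_mfderiv_symm {v : TB E Q} {x : E × E} (hx : x ∈ (tbChart v).target)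
    (y : E × E) : tbChartDeriv v ((tbChart v).symm x)
      (mfderiv 𝓘(ℝ, E × E) 𝓘(ℝ, E).tangent (tbChart v).symm x y) = y := by
  have h := mfderiv_extChartAt_comp_mfderivWithin_extChartAt_symm (I := 𝓘(ℝ, E).tangent)
    (x := v) hx
  rw [ModelWithCorners.range_eq_univ, mfderivWithin_univ] at h
  exact DFunLike.congr_fun h y

theorem mfderiv_symm_tbChartDeriv {v : TB E Q} {x : E × E} (hx : x ∈ (tbChart v).target)
    (Z : TTan ((tbChart v).symm x)) : mfderiv 𝓘(ℝ, E × E) 𝓘(ℝ, E).tangent (tbChart v).symm x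
      (tbChartDeriv v ((tbChart v).symm x) Z) = Z := by
  have h := mfderivWithin_extChartAt_symm_comp_mfderiv_extChartAt (I := 𝓘(ℝ, E).tangent)
    (x := v) hx
  rw [ModelWithCorners.range_eq_univ, mfderivWithin_univ] at h
  exact DFunLike.congr_fun h Z

/-- The representative of the 2-form `ω_L` in the chart at `v`. -/
def localOmega (L : TB E Q → ℝ) (v : TB E Q) (x : E × E) : E × E →L[ℝ] E × E →L[ℝ] ℝ :=
  (fderiv ℝ (localForm (cartanOneForm L) v) x).flip - fderiv ℝ (localForm (cartanOneForm L) v) x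

theorem contDiffAt_localForm_cartanOneForm {L : TB E Q → ℝ}
    (hL : ContMDiff 𝓘(ℝ, E).tangent 𝓘(ℝ, ℝ) ∞ L) {v : TB E Q} {x : E × E}
    (hx : x ∈ (tbChart v).target) : ContDiffAt ℝ ∞ (localForm (cartanOneForm L) v) x := by
  have h := ((contDiffAt_comp_tbChart_symm hL hx).fderiv_right (m := ∞) (by simp)).clm_comp
    (contDiffAt_const (c := (ContinuousLinearMap.inr ℝ E E).comp (ContinuousLinearMap.fst ℝ E E)))
  refine h.congr_of_eventuallyEq ?_
  filter_upwards [(isOpen_tbChart_target v).mem_nhds hx] with y hy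
  exact localForm_cartanOneForm hy ((hL _).mdifferentiableAt (by simp))

theorem _root_.ContDiffAt.clm_flip {V : Type*} [NormedAddCommGroup V] [NormedSpace ℝ V]
    {B : V → V →L[ℝ] V →L[ℝ] ℝ} {x : V} {n : WithTop ℕ∞} (hB : ContDiffAt ℝ n B x) :
    ContDiffAt ℝ n (fun y => (B y).flip) x := by
  have h : IsBoundedLinearMap ℝ fun B : V →L[ℝ] V →L[ℝ] ℝ => B.flip :=
    { map_add := fun _ _ => rfl
      map_smul := fun _ _ => rfl
      bound := ⟨1, one_pos, fun B => by rw [ContinuousLinearMap.opNorm_flip, one_mul]⟩ }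
  have h' : ContDiff ℝ n fun B : V →L[ℝ] V →L[ℝ] ℝ => B.flip :=
    IsBoundedLinearMap.contDiff (𝕜 := ℝ) (E := V →L[ℝ] V →L[ℝ] ℝ) (F := V →L[ℝ] V →L[ℝ] ℝ) h
  exact h'.contDiffAt.comp x hB

theorem contDiffAt_localOmega {L : TB E Q → ℝ}
    (hL : ContMDiff 𝓘(ℝ, E).tangent 𝓘(ℝ, ℝ) ∞ L) {v : TB E Q} {x : E × E}
    (hx : x ∈ (tbChart v).target) : ContDiffAt ℝ ∞ (localOmega L v) x := by
  have h := (contDiffAt_localForm_cartanOneForm hL hx).fderiv_right (m := ∞) (by simp)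
  exact h.clm_flip.sub h

theorem localOmega_apply {L : TB E Q → ℝ}
    (hL : ContMDiff 𝓘(ℝ, E).tangent 𝓘(ℝ, ℝ) ∞ L) {v : TB E Q} {x : E × E}
    (hx : x ∈ (tbChart v).target) (z y : E × E) : localOmega L v x z y =
      fderiv ℝ (fderiv ℝ (L ∘ (tbChart v).symm)) x y (0, z.1) -
      fderiv ℝ (fderiv ℝ (L ∘ (tbChart v).symm)) x z (0, y.1) := by
  have h := (((contDiffAt_comp_tbChart_symm hL hx).fderiv_right (m := ∞) (by simp)).differentiableAt
    (by simp)).hasFDerivAt.clm_comp (hasFDerivAt_const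
      ((ContinuousLinearMap.inr ℝ E E).comp (ContinuousLinearMap.fst ℝ E E)) x)
  have h' : localForm (cartanOneForm L) v =ᶠ[𝓝 x] fun y =>
      (fderiv ℝ (L ∘ (tbChart v).symm) y).comp
        ((ContinuousLinearMap.inr ℝ E E).comp (ContinuousLinearMap.fst ℝ E E)) := by
    filter_upwards [(isOpen_tbChart_target v).mem_nhds hx] with y hy
    exact localForm_cartanOneForm hy ((hL _).mdifferentiableAt (by simp))
  rw [localOmega, (h.congr_of_eventuallyEq h').fderiv]
  simp

theorem contractOmega_apply {L : TB E Q → ℝ}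
    (hL : ContMDiff 𝓘(ℝ, E).tangent 𝓘(ℝ, ℝ) ∞ L) {v u : TB E Q}
    (hu : u ∈ (tbChart v).source) (Z Y : TTan u) : contractOmega L u Z Y =
      localOmega L v (tbChart v u) (tbChartDeriv v u Z) (tbChartDeriv v u Y) := by
  have h := extDerivTB_apply (cartanOneForm L) hu
    ((contDiffAt_localForm_cartanOneForm hL ((tbChart v).map_source hu)).differentiableAt (by simp))
    Z Y
  have h' : contractOmega L u Z Y = - extDerivTB (cartanOneForm L) u Z Y := rfl
  rw [h', h, neg_sub]
  rfl

theorem tbChart_symm_base (q : Q) (w₀ w : E) :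
    (tbChart (⟨q, w₀⟩ : TB E Q)).symm (extChartAt 𝓘(ℝ, E) q q, w) = ⟨q, w⟩ := by
  have h := mfderivWithin_range_extChartAt_symm (I := 𝓘(ℝ, E)) (x := q)
  rw [ModelWithCorners.range_eq_univ, mfderivWithin_univ] at h
  have hx : ((extChartAt 𝓘(ℝ, E) q q, w) : E × E) ∈ (tbChart (⟨q, w₀⟩ : TB E Q)).target :=
    mem_tbChart_target.2 (mem_extChartAt_target (I := 𝓘(ℝ, E)) q)
  refine (tbChart_symm_apply hx).trans ?_
  exact congrArg₂ (fun (q : Q) (w : E) => (⟨q, w⟩ : TB E Q))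
    ((extChartAt 𝓘(ℝ, E) q).left_inv (mem_extChartAt_source q))
    (DFunLike.congr_fun h w)

theorem tbChart_self (q : Q) (w : E) :
    tbChart (⟨q, w⟩ : TB E Q) ⟨q, w⟩ = (extChartAt 𝓘(ℝ, E) q q, w) := by
  have hx : ((extChartAt 𝓘(ℝ, E) q q, w) : E × E) ∈ (tbChart (⟨q, w⟩ : TB E Q)).target :=
    mem_tbChart_target.2 (mem_extChartAt_target (I := 𝓘(ℝ, E)) q)
  have h := (tbChart (⟨q, w⟩ : TB E Q)).right_inv hx
  rwa [tbChart_symm_base] at h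

/-- In coordinates `ω_L` has block form with the fibre Hessian off the diagonal and a zero vertical
block. Vertical test vectors kill the base component of `z`, and horizontal ones then kill its fibre
component. -/
theorem localOmega_injective {L : TB E Q → ℝ} (hL : ContMDiff 𝓘(ℝ, E).tangent 𝓘(ℝ, ℝ) ∞ L)
    (hreg : IsRegularLagrangian L) (v : TB E Q) {z : E × E}
    (hz : localOmega L v (tbChart v v) z = 0) : z = 0 := by
  obtain ⟨q, w⟩ := v
  change E at w
  set v : TB E Q := ⟨q, w⟩ with hvdef
  have hx : tbChart v v ∈ (tbChart v).target := mem_extChartAt_target v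
  set x := tbChart v v with hxdef
  let ℓ := L ∘ (tbChart v).symm
  have hℓ : ContDiffAt ℝ ∞ ℓ x := contDiffAt_comp_tbChart_symm hL hx
  have hsym : ∀ a b, fderiv ℝ (fderiv ℝ ℓ) x a b = fderiv ℝ (fderiv ℝ ℓ) x b a :=
    hℓ.isSymmSndFDerivAt (by simpa using ENat.LEInfty.out)
  have hfun : (fun u : E => L ⟨q, u⟩) = fun u => ℓ (x.1, u) := by
    ext u
    rw [hxdef, hvdef, tbChart_self]
    exact congrArg L (tbChart_symm_base q w u).symm
  have hx2 : x = (x.1, w) := by rw [hxdef, hvdef, tbChart_self]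
  have hd1 : ∀ u, fderiv ℝ (fun u => ℓ (x.1, u)) u =
      (fderiv ℝ ℓ (x.1, u)).comp (ContinuousLinearMap.inr ℝ E E) := fun u =>
    (((contDiffAt_comp_tbChart_symm hL (mem_tbChart_target.2
      (mem_tbChart_target.1 hx : _) : (x.1, u) ∈ (tbChart v).target)).differentiableAt
      (by simp)).hasFDerivAt.comp u (hasFDerivAt_prodMk_right x.1 u)).fderiv
  have hd2 : ∀ a b, fderiv ℝ (fderiv ℝ (fun u : E => L ⟨q, u⟩)) w a b =
      fderiv ℝ (fderiv ℝ ℓ) x (0, a) (0, b) := by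
    intro a b
    have h1 : HasFDerivAt (fderiv ℝ ℓ) (fderiv ℝ (fderiv ℝ ℓ) x) (x.1, w) := by
      rw [← hx2]
      exact ((hℓ.fderiv_right (m := ∞) (by simp)).differentiableAt (by simp)).hasFDerivAt
    have h2 := (h1.comp w (hasFDerivAt_prodMk_right x.1 w)).clm_comp
      (hasFDerivAt_const (ContinuousLinearMap.inr ℝ E E) w)
    rw [hfun, funext hd1]
    refine (DFunLike.congr_fun (DFunLike.congr_fun h2.fderiv a) b).trans ?_
    simp
  have hΩ : ∀ y, fderiv ℝ (fderiv ℝ ℓ) x y (0, z.1) = fderiv ℝ (fderiv ℝ ℓ) x z (0, y.1) := by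
    intro y
    have := localOmega_apply hL hx z y
    rw [hz] at this
    exact sub_eq_zero.1 this.symm
  have hz1 : z.1 = 0 := by
    refine hreg ⟨q, w⟩ z.1 fun w' => ?_
    rw [hd2, hsym, hΩ]
    exact map_zero _
  have hz2 : z.2 = 0 := by
    refine hreg ⟨q, w⟩ z.2 fun w' => ?_
    rw [hd2]
    have := hΩ (w', 0)
    rw [hz1] at this
    have hz' : z = (0, z.2) := Prod.ext hz1 rfl
    rw [← hz', ← this]
    exact map_zero _
  exact Prod.ext hz1 hz2

theorem contractOmega_injective {L : TB E Q → ℝ} (hL : ContMDiff 𝓘(ℝ, E).tangent 𝓘(ℝ, ℝ) ∞ L)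
    (hreg : IsRegularLagrangian L) (v : TB E Q) {Z Z' : TTan v}
    (h : contractOmega L v Z = contractOmega L v Z') : Z = Z' := by
  have hvv : v ∈ (tbChart v).source := mem_extChartAt_source v
  have hid : tbChartDeriv v v = ContinuousLinearMap.id ℝ (E × E) :=
    mfderiv_extChartAt_self (I := 𝓘(ℝ, E).tangent) (x := v)
  have key : localOmega L v (tbChart v v) ((show E × E from Z) - (show E × E from Z')) = 0 := by
    refine ContinuousLinearMap.ext fun y => ?_
    have h1 := DFunLike.congr_fun h (show TTan v from y)
    rw [contractOmega_apply hL hvv, contractOmega_apply hL hvv, hid] at h1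
    rw [map_sub, sub_apply]
    exact sub_eq_zero.2 h1
  exact sub_eq_zero.1 (localOmega_injective hL hreg v key)

end ForcedField

/-! ### Smoothness of the energy and of the forced Lagrangian field -/

section ForcedFieldSmooth

variable {E : Type*} [NormedAddCommGroup E] [NormedSpace ℝ E]
  {Q : Type*} [TopologicalSpace Q] [ChartedSpace E Q] [IsManifold 𝓘(ℝ, E) ∞ Q]

theorem energy_tbChart_symm {L : TB E Q → ℝ} (hL : ContMDiff 𝓘(ℝ, E).tangent 𝓘(ℝ, ℝ) ∞ L)
    {v : TB E Q} {x : E × E} (hx : x ∈ (tbChart v).target) :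
    energy L ((tbChart v).symm x) =
      fderiv ℝ (L ∘ (tbChart v).symm) x (0, x.2) - (L ∘ (tbChart v).symm) x := by
  have h1 := vertLift_mfderiv_extChartAt_symm hx x.2
  have h2 : (show E from ((tbChart v).symm x).2) =
      mfderiv 𝓘(ℝ, E) 𝓘(ℝ, E) (extChartAt 𝓘(ℝ, E) v.proj).symm x.1 x.2 :=
    congrArg (fun p : TB E Q => (show E from p.2)) (tbChart_symm_apply hx)
  have h3 := diffTB_mfderiv_tbChart_symm hx ((hL _).mdifferentiableAt (by simp)) (0, x.2)
  refine congrArg (fun r : ℝ => r - (L ∘ (tbChart v).symm) x) ?_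
  refine Eq.trans (congrArg (diffTB L ((tbChart v).symm x)) ?_) h3
  exact (congrArg (vertLift ((tbChart v).symm x)) h2).trans h1

theorem contMDiff_energy {L : TB E Q → ℝ} (hL : ContMDiff 𝓘(ℝ, E).tangent 𝓘(ℝ, ℝ) ∞ L) :
    ContMDiff 𝓘(ℝ, E).tangent 𝓘(ℝ, ℝ) ∞ (energy L) := by
  intro v
  have hv : v ∈ (tbChart v).source := mem_extChartAt_source v
  have hx := (tbChart v).map_source hv
  have hℓ := contDiffAt_comp_tbChart_symm hL hx
  have h1 : ContDiffAt ℝ ∞ (fun x : E × E => fderiv ℝ (L ∘ (tbChart v).symm) x (0, x.2) -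
      (L ∘ (tbChart v).symm) x) (tbChart v v) :=
    ((hℓ.fderiv_right (m := ∞) (by simp)).clm_apply (contDiffAt_const.prodMk contDiffAt_snd)).sub hℓ
  refine (h1.contMDiffAt.comp v (contMDiffAt_tbChart hv)).congr_of_eventuallyEq ?_
  filter_upwards [(isOpen_extChartAt_source (I := 𝓘(ℝ, E).tangent) v).mem_nhds hv] with u hu
  have := energy_tbChart_symm hL ((tbChart v).map_source hu)
  rwa [(tbChart v).left_inv hu] at this

/-- The representative of an external force in the chart of `TQ` at `v`. -/
def localForce (F : Force E Q) (v : TB E Q) (x : E × E) : E →L[ℝ] ℝ :=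
  (F ((tbChart v).symm x)).comp
    (mfderiv 𝓘(ℝ, E) 𝓘(ℝ, E) (extChartAt 𝓘(ℝ, E) v.proj).symm x.1)

/-- The pairing of a smooth force with a smooth vector field along a map to `TQ`. -/
theorem IsSmoothForce.contDiffAt_apply {F : Force E Q} (hF : IsSmoothForce F)
    {V : Type*} [NormedAddCommGroup V] [NormedSpace ℝ V] {c : V → TB E Q}
    {w : (x : V) → Tan E (c x).proj} {x : V}
    (hc : ContMDiffAt 𝓘(ℝ, V) 𝓘(ℝ, E).tangent ∞ c x)
    (hw : ContMDiffAt 𝓘(ℝ, V) 𝓘(ℝ, E).tangent ∞ (fun y => (⟨(c y).proj, w y⟩ : TB E Q)) x) :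
    ContDiffAt ℝ ∞ (fun y => F (c y) (w y)) x := by
  have h1 := (hF (c x)).comp x hc
  have h2 := ContMDiffAt.clm_bundle_apply (F₁ := E) (F₂ := ℝ) (E₁ := TangentSpace 𝓘(ℝ, E))
    (E₂ := Bundle.Trivial Q ℝ) (b := fun y => (c y).proj) (ϕ := fun y => F (c y)) (v := w) h1 hw
  exact (Bundle.contMDiffAt_totalSpace.1 h2).2.contDiffAt

/-- In finite dimension an operator-valued map is smooth once its value on each fixed vector `a` is;
in the chart, `a` defines the smooth field `x ↦ (tbChart v).symm (x.1, a)`. -/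
theorem contDiffOn_localForce [FiniteDimensional ℝ E] {F : Force E Q} (hF : IsSmoothForce F)
    (v : TB E Q) : ContDiffOn ℝ ∞ (localForce F v) (tbChart v).target := by
  refine contDiffOn_clm_apply.2 fun a x hx => ContDiffAt.contDiffWithinAt ?_
  refine hF.contDiffAt_apply (contMDiffAt_tbChart_symm hx) ?_
  have hx' : ((x.1, a) : E × E) ∈ (tbChart v).target :=
    mem_tbChart_target.2 (mem_tbChart_target.1 hx)
  have h := ContMDiffAt.comp x (g := (tbChart v).symm) (f := fun y : E × E => ((y.1, a) : E × E))
    (contMDiffAt_tbChart_symm hx') (contDiffAt_fst.prodMk contDiffAt_const).contMDiffAt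
  refine h.congr_of_eventuallyEq ?_
  filter_upwards [(isOpen_tbChart_target v).mem_nhds hx] with y hy
  exact (tbChart_symm_apply (x := ((y.1, a) : E × E))
    (mem_tbChart_target.2 (mem_tbChart_target.1 hy))).symm

/-- The representative of the right-hand side `dE_L - μ_F` of the equations of motion. -/
def localRHS (L : TB E Q → ℝ) (F : Force E Q) (v : TB E Q) (x : E × E) : E × E →L[ℝ] ℝ :=
  fderiv ℝ (energy L ∘ (tbChart v).symm) x - (localForce F v x).comp (ContinuousLinearMap.fst ℝ E E)

theorem contDiffAt_localRHS [FiniteDimensional ℝ E] {L : TB E Q → ℝ}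
    (hL : ContMDiff 𝓘(ℝ, E).tangent 𝓘(ℝ, ℝ) ∞ L) {F : Force E Q} (hF : IsSmoothForce F)
    {v : TB E Q} {x : E × E} (hx : x ∈ (tbChart v).target) :
    ContDiffAt ℝ ∞ (localRHS L F v) x :=
  ((contDiffAt_comp_tbChart_symm (contMDiff_energy hL) hx).fderiv_right (m := ∞) (by simp)).sub
    (((contDiffOn_localForce hF v).contDiffAt ((isOpen_tbChart_target v).mem_nhds hx)).clm_comp
      contDiffAt_const)

theorem localRHS_apply {L : TB E Q → ℝ} (hL : ContMDiff 𝓘(ℝ, E).tangent 𝓘(ℝ, ℝ) ∞ L)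
    (F : Force E Q) {v : TB E Q} {x : E × E} (hx : x ∈ (tbChart v).target) (y : E × E) :
    (diffTB (energy L) ((tbChart v).symm x) - semibasic _ (F ((tbChart v).symm x)))
      (mfderiv 𝓘(ℝ, E × E) 𝓘(ℝ, E).tangent (tbChart v).symm x y) = localRHS L F v x y := by
  have h1 := diffTB_mfderiv_tbChart_symm hx ((contMDiff_energy hL _).mdifferentiableAt (by simp)) y
  have h2 := DFunLike.congr_fun (tanProj_comp_mfderiv_tbChart_symm hx) y
  exact congrArg₂ (· - ·) h1 (congrArg (F ((tbChart v).symm x)) h2)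

/-- The equation `i_Z ω_L = dE_L - μ_F` in the chart at `v`. -/
theorem contractOmega_eq_iff {L : TB E Q → ℝ} (hL : ContMDiff 𝓘(ℝ, E).tangent 𝓘(ℝ, ℝ) ∞ L)
    (F : Force E Q) {v : TB E Q} {x : E × E} (hx : x ∈ (tbChart v).target)
    (Z : TTan ((tbChart v).symm x)) :
    contractOmega L ((tbChart v).symm x) Z =
        diffTB (energy L) ((tbChart v).symm x) - semibasic _ (F ((tbChart v).symm x)) ↔
      localOmega L v x (tbChartDeriv v ((tbChart v).symm x) Z) = localRHS L F v x := by
  have key : ∀ y : E × E, contractOmega L ((tbChart v).symm x) Z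
      (mfderiv 𝓘(ℝ, E × E) 𝓘(ℝ, E).tangent (tbChart v).symm x y) =
        localOmega L v x (tbChartDeriv v ((tbChart v).symm x) Z) y := by
    intro y
    rw [contractOmega_apply hL (tbChart_symm_mem_source hx), (tbChart v).right_inv hx]
    exact congrArg _ (tbChartDeriv_mfderiv_symm hx y)
  constructor
  · intro h
    refine ContinuousLinearMap.ext fun y => ?_
    rw [← key, ← localRHS_apply hL F hx, h]
  · intro h
    refine ContinuousLinearMap.ext fun Y => ?_
    have hY := mfderiv_symm_tbChartDeriv hx Y
    rw [← hY, key, localRHS_apply hL F hx, h]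

theorem localOmega_isInvertible [FiniteDimensional ℝ E] {L : TB E Q → ℝ}
    (hL : ContMDiff 𝓘(ℝ, E).tangent 𝓘(ℝ, ℝ) ∞ L) (hreg : IsRegularLagrangian L) (v : TB E Q) :
    (localOmega L v (tbChart v v)).IsInvertible := by
  have hrank : Module.finrank ℝ (E × E) = Module.finrank ℝ (E × E →L[ℝ] ℝ) :=
    (Subspace.dual_finrank_eq (K := ℝ) (V := E × E)).symm.trans
      (LinearMap.toContinuousLinearMap (𝕜 := ℝ) (E := E × E) (F' := ℝ)).finrank_eq
  have hinj : Function.Injective (localOmega L v (tbChart v v)).toLinearMap :=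
    (injective_iff_map_eq_zero _).2 fun z hz => localOmega_injective hL hreg v hz
  exact ⟨(LinearEquiv.ofInjectiveOfFinrankEq _ hinj hrank).toContinuousLinearEquiv,
    ContinuousLinearMap.ext fun _ => rfl⟩

/-- The forced Lagrangian vector field is smooth. -/
theorem contMDiff_forcedField [FiniteDimensional ℝ E] {L : TB E Q → ℝ}
    (hL : ContMDiff 𝓘(ℝ, E).tangent 𝓘(ℝ, ℝ) ∞ L) (hreg : IsRegularLagrangian L)
    {F : Force E Q} (hF : IsSmoothForce F) :
    ContMDiff 𝓘(ℝ, E).tangent 𝓘(ℝ, E).tangent.tangent ∞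
      (fun v => (⟨v, forcedField L F v⟩ : TangentBundle 𝓘(ℝ, E).tangent (TB E Q))) := by
  have : CompleteSpace E := FiniteDimensional.complete ℝ E
  intro v
  refine (Bundle.contMDiffAt_section v).2 ?_
  have hv : v ∈ (tbChart v).source := mem_extChartAt_source v
  have hx := (tbChart v).map_source hv
  have hΩ := contDiffAt_localOmega hL hx
  obtain ⟨e, he⟩ := localOmega_isInvertible hL hreg v
  have hinv : ∀ᶠ x in 𝓝 (tbChart v v), (localOmega L v x).IsInvertible := by
    have := e.nhds
    rw [he] at this
    filter_upwards [hΩ.continuousAt.preimage_mem_nhds this] with x hx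
    exact hx
  -- The coordinate expression of the field is `ω_L⁻¹ (dE_L - μ_F)`, and operator inversion is
  -- smooth at an invertible operator.
  have hsm : ContDiffAt ℝ ∞ (fun x => (localOmega L v x).inverse (localRHS L F v x)) (tbChart v v) :=
    (ContDiffAt.comp (tbChart v v)
      (ContinuousLinearMap.IsInvertible.contDiffAt_map_inverse (localOmega_isInvertible hL hreg v))
      hΩ).clm_apply (contDiffAt_localRHS hL hF hx)
  refine (hsm.contMDiffAt.comp v (contMDiffAt_tbChart hv)).congr_of_eventuallyEq ?_
  filter_upwards [(isOpen_extChartAt_source (I := 𝓘(ℝ, E).tangent) v).mem_nhds hv,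
    (contMDiffAt_tbChart hv).continuousAt.eventually hinv] with u hu hui
  have hxu := (tbChart v).map_source hu
  have h1 : (trivializationAt (E × E) (TangentSpace 𝓘(ℝ, E).tangent) v
      ⟨u, forcedField L F u⟩).2 = tbChartDeriv v u (forcedField L F u) := by
    have hu' : u ∈ (chartAt (ModelProd E E) v).source := by
      rwa [← extChartAt_source 𝓘(ℝ, E).tangent]
    have h2 := TangentBundle.continuousLinearMapAt_trivializationAt (I := 𝓘(ℝ, E).tangent) hu'
    have h3 := DFunLike.congr_fun h2 (forcedField L F u)
    have h4 := congrFun (Bundle.Trivialization.coe_linearMapAt_of_mem (R := ℝ)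
      (trivializationAt (E × E) (TangentSpace 𝓘(ℝ, E).tangent) v) (b := u) hu') (forcedField L F u)
    exact h4.symm.trans h3
  refine h1.trans ?_
  change _ = (localOmega L v (tbChart v u)).inverse (localRHS L F v (tbChart v u))
  have hleft : (tbChart v).symm (tbChart v u) = u := (tbChart v).left_inv hu
  -- Replacing `u` by `(tbChart v).symm x` puts its tangent space in the form used by the local
  -- equation of motion.
  generalize tbChart v u = x at hxu hui hleft ⊢
  subst hleft
  have hex : ∃ Z : TTan ((tbChart v).symm x), contractOmega L ((tbChart v).symm x) Z =
      diffTB (energy L) ((tbChart v).symm x) - semibasic _ (F ((tbChart v).symm x)) := by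
    refine ⟨mfderiv 𝓘(ℝ, E × E) 𝓘(ℝ, E).tangent (tbChart v).symm x
      ((localOmega L v x).inverse (localRHS L F v x)), ?_⟩
    rw [contractOmega_eq_iff hL F hxu, tbChartDeriv_mfderiv_symm hxu, hui.self_apply_inverse]
  have hsp := (contractOmega_eq_iff hL F hxu _).1 (Classical.epsilon_spec hex)
  exact (hui.inverse_apply_eq.2 hsp.symm).symm

end ForcedFieldSmooth

/-! ### Existence of the nonholonomic field and its agreement with the forced one -/

section NonholonomicField

/-- A linear system whose solutions are constrained to `K`, up to reactions in `R`: uniqueness and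
the matching of the dimensions give existence. -/
theorem exists_mem_sub_mem_of_finrank_eq {V : Type*} [AddCommGroup V] [Module ℝ V]
    [FiniteDimensional ℝ V] (K : Submodule ℝ V) (R : Submodule ℝ (Module.Dual ℝ V))
    (Ω : V →ₗ[ℝ] Module.Dual ℝ V) (hdim : Module.finrank ℝ K.dualAnnihilator = Module.finrank ℝ R)
    (hinj : ∀ Z ∈ K, Ω Z ∈ R → Z = 0) (β : Module.Dual ℝ V) : ∃ Z ∈ K, Ω Z - β ∈ R := by
  -- Uniqueness says that `T` is injective. The dimension hypothesis equates the dimensions of `K`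
  -- and of the quotient by `R`, so `T` is onto.
  let T : K →ₗ[ℝ] Module.Dual ℝ V ⧸ R := R.mkQ ∘ₗ Ω ∘ₗ K.subtype
  have hT : Function.Injective T := by
    refine (injective_iff_map_eq_zero T).2 fun z hz => ?_
    exact Subtype.ext (hinj z z.2 ((Submodule.Quotient.mk_eq_zero R).1 hz))
  have hrank : Module.finrank ℝ K = Module.finrank ℝ (Module.Dual ℝ V ⧸ R) := by
    have h1 := Subspace.finrank_add_finrank_dualAnnihilator_eq K
    have h2 := Submodule.finrank_quotient_add_finrank R
    have h3 := Subspace.dual_finrank_eq (K := ℝ) (V := V)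
    omega
  obtain ⟨z, hz⟩ := (LinearMap.injective_iff_surjective_of_finrank_eq_finrank hrank).1 hT (R.mkQ β)
  exact ⟨z, z.2, (Submodule.Quotient.eq R).1 hz⟩

variable {E : Type*} [NormedAddCommGroup E] [NormedSpace ℝ E]
  {Q : Type*} [TopologicalSpace Q] [ChartedSpace E Q] [IsManifold 𝓘(ℝ, E) ∞ Q]
  {L : TB E Q → ℝ} {D : (q : Q) → Submodule ℝ (Tan E q)}

theorem exists_linearMap_eq_antisymm_comp {T V : Type*} [AddCommGroup T] [Module ℝ T]
    [TopologicalSpace T] [IsTopologicalAddGroup T] [NormedAddCommGroup V] [NormedSpace ℝ V]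
    (A : V →L[ℝ] V →L[ℝ] ℝ) (P : T →L[ℝ] V) : ∃ Ω : T →ₗ[ℝ] Module.Dual ℝ T, ∀ Z,
      Ω Z = (-((A (P Z)).comp P - (A.flip (P Z)).comp P)).toLinearMap := by
  refine ⟨{ toFun := fun Z => (-((A (P Z)).comp P - (A.flip (P Z)).comp P)).toLinearMap
            map_add' := fun Z Z' => LinearMap.ext fun Y => ?_
            map_smul' := fun a Z => LinearMap.ext fun Y => ?_ }, fun Z => rfl⟩
  · simp
    ring
  · simp
    ring

theorem exists_linearMap_eq_contractOmega (L : TB E Q → ℝ) (v : TB E Q) :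
    ∃ Ω : TTan v →ₗ[ℝ] Module.Dual ℝ (TTan v), ∀ Z, Ω Z = (contractOmega L v Z).toLinearMap :=
  exists_linearMap_eq_antisymm_comp _ _

/-- Admissibility supplies the equality of dimensions and compatibility the injectivity, so the
choice defining `nhField` has a solution to pick. -/
theorem nhField_spec [FiniteDimensional ℝ E] (hadm : Admissible D) (hcomp : Compatible L D)
    {v : TB E Q} (hv : v ∈ distSet D) : nhField L D v ∈ tanDist D v ∧
      (contractOmega L v (nhField L D v) - diffTB (energy L) v).toLinearMap ∈
        reactionForms D v := by
  have : FiniteDimensional ℝ (TTan v) := inferInstanceAs (FiniteDimensional ℝ (E × E))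
  obtain ⟨Ω, hΩ⟩ := exists_linearMap_eq_contractOmega L v
  obtain ⟨Z, hZ, hZ'⟩ := exists_mem_sub_mem_of_finrank_eq (tanDist D v) (reactionForms D v)
    Ω (hadm v hv) (fun Z hZ h => hcomp v hv Z hZ (hΩ Z ▸ h)) (diffTB (energy L) v).toLinearMap
  rw [hΩ] at hZ'
  exact Classical.epsilon_spec (p := fun Z : TTan v => Z ∈ tanDist D v ∧
    (contractOmega L v Z - diffTB (energy L) v).toLinearMap ∈ reactionForms D v) ⟨Z, hZ, hZ'⟩

/-- A reaction form is `S^* a = a ∘ vertLift ∘ tanProj`, hence semibasic; the force is `-(a ∘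
vertLift)`. -/
theorem nhForce_spec [FiniteDimensional ℝ E] (hadm : Admissible D) (hcomp : Compatible L D)
    {v : TB E Q} (hv : v ∈ distSet D) : contractOmega L v (nhField L D v) =
      diffTB (energy L) v - semibasic v (nhForce L D v) := by
  have : FiniteDimensional ℝ (Tan E v.proj) := inferInstanceAs (FiniteDimensional ℝ E)
  obtain ⟨a, -, ha⟩ := (nhField_spec hadm hcomp hv).2
  refine Classical.epsilon_spec (p := fun α : Tan E v.proj →L[ℝ] ℝ =>
    contractOmega L v (nhField L D v) = diffTB (energy L) v - semibasic v α)
    ⟨-LinearMap.toContinuousLinearMap (𝕜 := ℝ) (E := E) (F' := ℝ)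
      (a ∘ₗ (vertLift v).toLinearMap : Tan E v.proj →ₗ[ℝ] ℝ), ?_⟩
  refine ContinuousLinearMap.ext fun Y => ?_
  have h : a (vertLift v (tanProj v Y)) =
    contractOmega L v (nhField L D v) Y - diffTB (energy L) v Y := DFunLike.congr_fun ha Y
  change contractOmega L v (nhField L D v) Y =
    diffTB (energy L) v Y - -(a (vertLift v (tanProj v Y)))
  rw [h]
  ring

/-- The nonholonomic dynamics is the forced dynamics of any extension of the nonholonomic force. -/
theorem forcedField_eq_nhField [FiniteDimensional ℝ E]
    (hL : ContMDiff 𝓘(ℝ, E).tangent 𝓘(ℝ, ℝ) ∞ L) (hreg : IsRegularLagrangian L)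
    (hadm : Admissible D) (hcomp : Compatible L D) {F : Force E Q} {v : TB E Q}
    (hv : v ∈ distSet D) (hext : F v = nhForce L D v) : forcedField L F v = nhField L D v := by
  have h := nhForce_spec hadm hcomp hv
  rw [← hext] at h
  exact contractOmega_injective hL hreg v ((Classical.epsilon_spec (p := fun Z : TTan v =>
    contractOmega L v Z = diffTB (energy L) v - semibasic v (F v)) ⟨_, h⟩).trans h.symm)

end NonholonomicField

/-! ### Comparing the flow on a subset with the ambient flow -/

section Flow

variable {F : Type*} [NormedAddCommGroup F] [NormedSpace ℝ F]
  {H : Type*} [TopologicalSpace H] {J : ModelWithCorners ℝ F H}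
  {M : Type*} [TopologicalSpace M] [ChartedSpace H M] {V V' : (x : M) → TangentSpace J x}

theorem FlowsTo.congr {N N' : Set M} (hN : N ⊆ N') (hV : EqOn V V' N) {t : ℝ} {x w : M}
    (h : FlowsTo J V N t x w) : FlowsTo J V' N' t x w := by
  obtain ⟨a, b, γ, h0, ht, hx, hw, hγN, hγ⟩ := h
  refine ⟨a, b, γ, h0, ht, hx, hw, fun s hs => hN (hγN s hs), fun s hs => ?_⟩
  rw [← hV (hγN s hs)]
  exact hγ s hs

theorem flowsTo_flow {N : Set M} {t : ℝ} {x : M} (h : ∃ w, FlowsTo J V N t x w) :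
    FlowsTo J V N t x (flow J V N t x) := by
  rw [flow, dif_pos h]
  exact h.choose_spec

theorem FlowsTo.mem {N : Set M} {t : ℝ} {x w : M} (h : FlowsTo J V N t x w) : w ∈ N := by
  obtain ⟨a, b, γ, -, ht, -, rfl, hγ, -⟩ := h
  exact hγ t ht

/-- The flow of a vector field on a subset, where it agrees with a vector field on the manifold. -/
theorem flow_eq_flow_of_eqOn [J.Boundaryless] [IsManifold J ∞ M] [T2Space M]
    (hV' : ContMDiff J J.tangent 1 (fun x => (⟨x, V' x⟩ : TangentBundle J M))) {N : Set M}
    (hV : EqOn V V' N) {h t : ℝ} (ht : t ∈ Icc 0 h) {x : M} (hx : x ∈ flowDomain J V N h) :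
    flow J V' univ t x = flow J V N t x :=
  ((flowsTo_flow (hx.2 t ht)).congr (subset_univ N) hV).flow_eq hV'

theorem flow_mem {N : Set M} {h t : ℝ} (ht : t ∈ Icc 0 h) {x : M} (hx : x ∈ flowDomain J V N h) :
    flow J V N t x ∈ N :=
  (flowsTo_flow (hx.2 t ht)).mem

end Flow

/-! ### Derivatives within a subset along its tangent vectors -/

section MFDeriv

variable {F : Type*} [NormedAddCommGroup F] [NormedSpace ℝ F]
  {H : Type*} [TopologicalSpace H] {J : ModelWithCorners ℝ F H}
  {M : Type*} [TopologicalSpace M] [ChartedSpace H M]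
  {F' : Type*} [NormedAddCommGroup F'] [NormedSpace ℝ F']
  {H' : Type*} [TopologicalSpace H'] {J' : ModelWithCorners ℝ F' H'}
  {M' : Type*} [TopologicalSpace M'] [ChartedSpace H' M']

/-- On vectors tangent to `N`, the derivative within `N` is that of any differentiable extension. -/
theorem mfderivWithin_apply_of_mem_tangentSub {f g : M → M'} {N : Set M} {p : M}
    (hf : MDifferentiableAt J J' f p) (hgf : EqOn g f N) (hp : p ∈ N) {X : TangentSpace J p}
    (hX : X ∈ tangentSub J N p) :
    (show F' from mfderivWithin J J' g N p X) = (show F' from mfderiv J J' f p X) := by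
  have hg : HasMFDerivWithinAt J J' g N p (mfderivWithin J J' g N p) :=
    (hf.mdifferentiableWithinAt.congr (fun y hy => hgf hy) (hgf hp)).hasMFDerivWithinAt
  -- The set `N` need not have unique derivatives, so the two maps are compared only on tangent
  -- vectors. A generator is the velocity of a curve in `N`, along which `f` and `g` coincide;
  -- linearity extends this to the span.
  have key : ∀ X : TangentSpace J p, X ∈ tangentSub J N p →
      (show F →L[ℝ] F' from mfderivWithin J J' g N p) (show F from X) =
        (show F →L[ℝ] F' from mfderiv J J' f p) (show F from X) := by
    intro X hX
    refine Submodule.span_induction ?_ ((map_zero _).trans (map_zero _).symm) ?_ ?_ hX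
    · rintro X ⟨c, rfl, -, hcN, hc⟩
      have h1 := (hf.hasMFDerivAt).comp (0 : ℝ) hc
      have h2 := HasMFDerivWithinAt.comp (0 : ℝ) hg (hc.hasMFDerivWithinAt (s := c ⁻¹' N))
        Subset.rfl
      have h3 := h2.hasMFDerivAt (show c ⁻¹' N ∈ 𝓝 (0 : ℝ) from hcN)
      have h4 : g ∘ c =ᶠ[𝓝 0] f ∘ c := hcN.mono fun s hs => hgf hs
      have h5 := hasMFDerivAt_unique (h3.congr_of_eventuallyEq h4.symm) h1
      have h6 : (1 : ℝ) • (show F from X) = X := one_smul _ _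
      exact (congrArg (show F →L[ℝ] F' from mfderivWithin J J' g N (c 0)) h6.symm).trans
        ((DFunLike.congr_fun h5 (1 : ℝ)).trans
          (congrArg (show F →L[ℝ] F' from mfderiv J J' f (c 0)) h6))
    · intro x y _ _ hx hy
      exact (map_add _ _ _).trans ((congrArg₂ (· + ·) hx hy).trans (map_add _ _ _).symm)
    · intro a x _ hx
      exact (map_smul _ _ _).trans ((congrArg (a • ·) hx).trans (map_smul _ _ _).symm)
  exact key X hX

end MFDeriv

/-! ### Exact retractions, forced variations and comparison of trajectories -/

section ExactRetraction

variable {E : Type*} [NormedAddCommGroup E] [NormedSpace ℝ E]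
  {Q : Type*} [TopologicalSpace Q] [ChartedSpace E Q]

theorem retraction_spec {f : TB E Q → Q × Q} {A : Set (TB E Q)} {p : Q × Q} (hp : p ∈ f '' A) :
    retraction f A p ∈ A ∧ f (retraction f A p) = p := by
  have h : ∃ v ∈ A, f v = p := hp
  rw [retraction, dif_pos h]
  exact h.choose_spec

theorem retraction_apply {f : TB E Q → Q × Q} {A : Set (TB E Q)} (hf : InjOn f A) {v : TB E Q}
    (hv : v ∈ A) : retraction f A (f v) = v :=
  hf (retraction_spec (mem_image_of_mem f hv)).1 hv (retraction_spec (mem_image_of_mem f hv)).2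

variable [IsManifold 𝓘(ℝ, E) ∞ Q]

theorem mdifferentiableAt_retraction {f : TB E Q → Q × Q} {A : Set (TB E Q)} (hA : IsOpen A)
    (hinj : InjOn f A)
    (hf : IsLocalDiffeomorphOn 𝓘(ℝ, E).tangent (𝓘(ℝ, E).prod 𝓘(ℝ, E)) ∞ f A) {p : Q × Q}
    (hp : p ∈ f '' A) :
    MDifferentiableAt (𝓘(ℝ, E).prod 𝓘(ℝ, E)) 𝓘(ℝ, E).tangent (retraction f A) p := by
  obtain ⟨v, hv, rfl⟩ := hp
  have hfv := hf ⟨v, hv⟩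
  have hd := hfv.localInverse_mdifferentiableAt (by simp)
  refine hd.congr_of_eventuallyEq ?_
  -- Close to `f v` the local inverse takes values in `A`, where injectivity of `f` identifies it
  -- with the retraction.
  have hA' : A ∈ 𝓝 (hfv.localInverse (f v)) := by
    rw [hfv.localInverse_left_inv hfv.localInverse_mem_target]
    exact hA.mem_nhds hv
  filter_upwards [hd.continuousAt hA',
    hfv.localInverse_open_source.mem_nhds hfv.localInverse_mem_source] with q hqA hq
  have h := retraction_apply hinj hqA
  rwa [hfv.localInverse_right_inv hq] at h

theorem IsSmoothForce.continuousOn_apply {F : Force E Q} (hF : IsSmoothForce F) {c : ℝ → TB E Q}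
    {w : (t : ℝ) → Tan E (c t).proj} {s : Set ℝ} (hc : ContinuousOn c s)
    (hw : ContinuousOn (fun t => (⟨(c t).proj, w t⟩ : TB E Q)) s) :
    ContinuousOn (fun t => F (c t) (w t)) s := by
  intro t ht
  have h1 := ((hF (c t)).of_le (m := 0) (by simp)).comp_contMDiffWithinAt t (I := 𝓘(ℝ, ℝ))
    (contMDiffOn_zero_iff.2 hc t ht)
  have h2 := ContMDiffWithinAt.clm_bundle_apply (F₁ := E) (F₂ := ℝ) (E₁ := TangentSpace 𝓘(ℝ, E))
    (E₂ := Bundle.Trivial Q ℝ) (b := fun t => (c t).proj) (ϕ := fun t => F (c t)) (v := w) h1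
    (contMDiffOn_zero_iff.2 hw t ht)
  exact (Bundle.contMDiffWithinAt_totalSpace.1 h2).2.continuousWithinAt

variable [FiniteDimensional ℝ E] [T2Space Q] {L : TB E Q → ℝ} {F : Force E Q} {h : ℝ}
  {W : Set (TB E Q)} {p : Q × Q}

/-- The variations `T_p (τ ∘ φ_t ∘ R) X` along a forced trajectory. -/
theorem mdifferentiableAt_forcedCurve (hL : ContMDiff 𝓘(ℝ, E).tangent 𝓘(ℝ, ℝ) ∞ L)
    (hreg : IsRegularLagrangian L) (hF : IsSmoothForce F) (hh : 0 ≤ h)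
    (hW : IsRetractionDomain L F h W) (hp : p ∈ expMap (forcedField L F) univ h '' W) :
    (∀ t ∈ Icc 0 h, MDifferentiableAt (𝓘(ℝ, E).prod 𝓘(ℝ, E)) 𝓘(ℝ, E)
      (fun p' => (forcedCurve L F h W t p').proj) p) ∧
    ∀ X : TangentSpace (𝓘(ℝ, E).prod 𝓘(ℝ, E)) p,
      ContinuousOn (fun t => F (forcedCurve L F h W t p)
        (mfderiv (𝓘(ℝ, E).prod 𝓘(ℝ, E)) 𝓘(ℝ, E) (fun p' => (forcedCurve L F h W t p').proj) p X))
        (Icc 0 h) := by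
  have : CompleteSpace E := FiniteDimensional.complete ℝ E
  have hR := mdifferentiableAt_retraction hW.1 hW.2.2.1 hW.2.2.2 hp
  have hproj : ContMDiff 𝓘(ℝ, E).tangent 𝓘(ℝ, E) 1 (fun u : TB E Q => u.proj) :=
    Bundle.contMDiff_proj (TangentSpace 𝓘(ℝ, E))
  obtain ⟨h1, h2⟩ := mdifferentiableAt_flow ((contMDiff_forcedField hL hreg hF).of_le
    (m := 2) ENat.LEInfty.out) hh
    (mem_of_superset (hW.1.mem_nhds (retraction_spec hp).1) hW.2.1)
  have h3 : ∀ t, MDifferentiableAt 𝓘(ℝ, E).tangent 𝓘(ℝ, E) (fun u : TB E Q => u.proj)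
      (forcedCurve L F h W t p) := fun t => (hproj _).mdifferentiableAt (by simp)
  have h4 : ∀ t ∈ Icc 0 h, MDifferentiableAt (𝓘(ℝ, E).prod 𝓘(ℝ, E)) 𝓘(ℝ, E).tangent
      (forcedCurve L F h W t) p := fun t ht => (h1 t ht).comp p hR
  refine ⟨fun t ht => (h3 t).comp p (h4 t ht), fun X => hF.continuousOn_apply ?_ ?_⟩
  -- Continuity of the trajectory is read off from the tangent curve of the zero vector by
  -- forgetting its fibre part.
  · exact (FiberBundle.continuous_proj (E × E) (TangentSpace 𝓘(ℝ, E).tangent)).comp_continuousOn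
      (h2 0)
  · refine ((hproj.continuous_tangentMap le_rfl).comp_continuousOn
      (h2 (mfderiv (𝓘(ℝ, E).prod 𝓘(ℝ, E)) 𝓘(ℝ, E).tangent
        (retraction (expMap (forcedField L F) univ h) W) p X))).congr fun t ht => ?_
    have h5 := mfderiv_comp p (h3 t) (h4 t ht)
    have h6 := mfderiv_comp p (h1 t ht) hR
    refine congrArg (Bundle.TotalSpace.mk' E (forcedCurve L F h W t p).proj) ?_
    exact (DFunLike.congr_fun h5 X).trans (congrArg _ (DFunLike.congr_fun h6 X))

theorem discreteForceMinus_add_discreteForcePlus (hL : ContMDiff 𝓘(ℝ, E).tangent 𝓘(ℝ, ℝ) ∞ L)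
    (hreg : IsRegularLagrangian L) (hF : IsSmoothForce F) (hh : 0 ≤ h)
    (hW : IsRetractionDomain L F h W) (hp : p ∈ expMap (forcedField L F) univ h '' W)
    (X₀ : Tan E p.1) (X₁ : Tan E p.2) :
    discreteForceMinus L F h W p X₀ + discreteForcePlus L F h W p X₁ =
      doubleDiscreteForce L F h W p X₀ X₁ := by
  have hc := (mdifferentiableAt_forcedCurve hL hreg hF hh hW hp).2
  have hX : pairVec p X₀ X₁ = pairVec p X₀ 0 + pairVec p 0 X₁ :=
    Prod.ext (add_zero (show E from X₀)).symm (zero_add (show E from X₁)).symm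
  refine (intervalIntegral.integral_add ((hc (pairVec p X₀ 0)).intervalIntegrable_of_Icc hh)
    ((hc (pairVec p 0 X₁)).intervalIntegrable_of_Icc hh)).symm.trans ?_
  refine intervalIntegral.integral_congr fun t _ => ?_
  simp only [hX, map_add]

variable {D : (q : Q) → Submodule ℝ (Tan E q)} {U : Set (TB E Q)}

/-- The nonholonomic trajectories are trajectories of the forced system. -/
theorem nhCurve_eq_forcedCurve (hL : ContMDiff 𝓘(ℝ, E).tangent 𝓘(ℝ, ℝ) ∞ L)
    (hreg : IsRegularLagrangian L) (hF : IsSmoothForce F) (hadm : Admissible D)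
    (hcomp : Compatible L D) (hext : ∀ v ∈ distSet D, F v = nhForce L D v) (hh : 0 ≤ h)
    (hW : IsRetractionDomain L F h W)
    (hUdom : U ⊆ flowDomain 𝓘(ℝ, E).tangent (nhField L D) (distSet D) h) (hUW : U ⊆ W)
    (hp : p ∈ discreteConstraint L D h U) : p ∈ expMap (forcedField L F) univ h '' W ∧
      ∀ t ∈ Icc 0 h, nhCurve L D h U t p ∈ distSet D ∧
        nhCurve L D h U t p = forcedCurve L F h W t p := by
  have hV : ContMDiff 𝓘(ℝ, E).tangent 𝓘(ℝ, E).tangent.tangent 1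
      (fun v => (⟨v, forcedField L F v⟩ : TangentBundle 𝓘(ℝ, E).tangent (TB E Q))) :=
    (contMDiff_forcedField hL hreg hF).of_le (by exact_mod_cast le_top)
  have hfield : EqOn (nhField L D) (forcedField L F) (distSet D) := fun v hv =>
    (forcedField_eq_nhField hL hreg hadm hcomp hv (hext v hv)).symm
  have hflow : ∀ v ∈ U, ∀ t ∈ Icc 0 h, flow 𝓘(ℝ, E).tangent (forcedField L F) univ t v =
      flow 𝓘(ℝ, E).tangent (nhField L D) (distSet D) t v := fun v hv t ht =>
    flow_eq_flow_of_eqOn hV hfield ht (hUdom hv)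
  obtain ⟨hvU, hvp⟩ := retraction_spec hp
  have hexp : expMap (forcedField L F) univ h (retraction (nhExp L D h) U p) = p := by
    refine Eq.trans ?_ hvp
    exact congrArg (fun u : TB E Q => ((retraction (nhExp L D h) U p).proj, u.proj))
      (hflow _ hvU h ⟨hh, le_rfl⟩)
  -- The point `p` has its nonholonomic preimage in `U ⊆ W`; since the forced exponential map sends
  -- it to `p` too, injectivity on `W` makes it the forced preimage.
  have hret : retraction (expMap (forcedField L F) univ h) W p = retraction (nhExp L D h) U p := by
    have := retraction_apply hW.2.2.1 (hUW hvU)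
    rwa [hexp] at this
  refine ⟨⟨_, hUW hvU, hexp⟩, fun t ht => ⟨flow_mem ht (hUdom hvU), ?_⟩⟩
  rw [nhCurve, forcedCurve, hret]
  exact (hflow _ hvU t ht).symm

end ExactRetraction

end Nonholonomic

end

/-! ### The restriction of the forced discrete objects to the constraint set -/

theorem proposition6p3
    {E : Type*} [NormedAddCommGroup E] [NormedSpace ℝ E] [FiniteDimensional ℝ E]
    {Q : Type*} [TopologicalSpace Q] [T2Space Q] [ChartedSpace E Q] [IsManifold 𝓘(ℝ, E) ∞ Q]
    -- a regular Lagrangian and a regular nonholonomic system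
    (L : TangentBundle 𝓘(ℝ, E) Q → ℝ)
    (hL : ContMDiff 𝓘(ℝ, E).tangent 𝓘(ℝ, ℝ) ∞ L)
    (hLreg : Nonholonomic.IsRegularLagrangian L)
    (D : (q : Q) → Submodule ℝ (TangentSpace 𝓘(ℝ, E) q)) (r : ℕ)
    (hD : Nonholonomic.IsSmoothDistribution D r)
    (hadm : Nonholonomic.Admissible D)
    (hcomp : Nonholonomic.Compatible L D)
    -- an arbitrary smooth extension of the nonholonomic force
    (F : Nonholonomic.Force E Q)
    (hF : Nonholonomic.IsSmoothForce F)
    (hext : ∀ v ∈ Nonholonomic.distSet D, F v = Nonholonomic.nhForce L D v)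
    (h : ℝ) (hh : 0 < h)
    -- the domains of the exact retractions
    (W : Set (TangentBundle 𝓘(ℝ, E) Q))
    (hW : Nonholonomic.IsRetractionDomain L F h W)
    (U : Set (TangentBundle 𝓘(ℝ, E) Q))
    (hUopen : ∃ O : Set (TangentBundle 𝓘(ℝ, E) Q), IsOpen O ∧ U = O ∩ Nonholonomic.distSet D)
    (hUdom : U ⊆ Nonholonomic.flowDomain 𝓘(ℝ, E).tangent (Nonholonomic.nhField L D)
      (Nonholonomic.distSet D) h)
    (hUW : U ⊆ W) :
    (∀ p ∈ Nonholonomic.discreteConstraint L D h U,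
      Nonholonomic.forcedDiscreteLagrangian L F h W p
        = Nonholonomic.nhDiscreteLagrangian L D h U p) ∧
    (∀ p ∈ Nonholonomic.discreteConstraint L D h U,
      ∀ (X₀ : TangentSpace 𝓘(ℝ, E) p.1) (X₁ : TangentSpace 𝓘(ℝ, E) p.2),
        Nonholonomic.pairVec p X₀ X₁ ∈
          Nonholonomic.tangentSub (𝓘(ℝ, E).prod 𝓘(ℝ, E))
            (Nonholonomic.discreteConstraint L D h U) p →
        Nonholonomic.discreteForceMinus L F h W p X₀ + Nonholonomic.discreteForcePlus L F h W p X₁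
          = Nonholonomic.betaForm L D h U p X₀ X₁) := by
  have hcurve : ∀ p ∈ Nonholonomic.discreteConstraint L D h U, _ := fun p hp =>
    Nonholonomic.nhCurve_eq_forcedCurve hL hLreg hF hadm hcomp hext hh.le hW hUdom hUW hp
  refine ⟨fun p hp => ?_, fun p hp X₀ X₁ hX => ?_⟩
  · refine intervalIntegral.integral_congr fun t ht => ?_
    rw [uIcc_of_le hh.le] at ht
    exact congrArg L ((hcurve p hp).2 t ht).2.symm
  · rw [Nonholonomic.discreteForceMinus_add_discreteForcePlus hL hLreg hF hh.le hW (hcurve p hp).1]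
    refine intervalIntegral.integral_congr fun t ht => ?_
    rw [uIcc_of_le hh.le] at ht
    obtain ⟨hmem, heq⟩ := (hcurve p hp).2 t ht
    have hd := Nonholonomic.mfderivWithin_apply_of_mem_tangentSub
      ((Nonholonomic.mdifferentiableAt_forcedCurve hL hLreg hF hh.le hW (hcurve p hp).1).1 t ht)
      (g := fun p' => (Nonholonomic.nhCurve L D h U t p').proj)
      (fun p' hp' => congrArg Bundle.TotalSpace.proj ((hcurve p' hp').2 t ht).2) hp hX
    -- The extension `F` may be replaced by the nonholonomic force because the trajectory stays in
    -- `D`.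
    have hforce : ∀ Y : E, F (Nonholonomic.forcedCurve L F h W t p) Y =
        Nonholonomic.nhForce L D (Nonholonomic.nhCurve L D h U t p) Y := by
      intro Y
      rw [← heq, hext _ hmem]
    exact (hforce _).trans (congrArg (Nonholonomic.nhForce L D _) hd.symm)
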